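/- **Setting.** Let $V$ be a $d$-dimensional real vector space with basis $e_1,\dots,e_d$, let $[d]^*=\bigcup_{m\ge 0}\{1,\dots,d\}^m$ be the set of tuples, and for $\tau=(i_1,\dots,i_m)$ put $e_\tau=e_{i_1}\otimes\cdots\otimes e_{i_m}$. Write $T(V)=\bigoplus_m V^{\otimes m}$, $T((V))=\prod_m V^{\otimes m}$, and $\langle x,f\rangle=\sum_\tau x_\tau f_\tau$ for $x\in T((V))$, $f\in T(V)$. Let $ \mathbin{\sqcup\!\sqcup} $ be the shuffle product on $T(V)$, i.e. the bilinear extension of $e_{\tau_1} \mathbin{\sqcup\!\sqcup} e_{\tau_2}=\sum_{\tau\in \mathrm{Sh}(\tau_1,\tau_2)}e_\tau$, shuffles being counted with multiplicity. For $x\in T((V))$ with constant term $1$ put $\log x=\sum_{n\ge1}\frac{(-1)^{n-1}}{n}(x-1)^{\otimes n}$. Give $T((V))$ the topology of the (extended) norms $\|x\|_\lambda=\sum_n\|x^n\|\lambda^n$, $\lambda>0$. For $p\ge1$, a *weakly geometric $p$-rough path* is a map $(s,t)\mapsto\mathbf x_{s,t}\in T((V))$, $0\le s\le t\le T$ (for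 some $T>0$), such that each $\mathbf x_{s,t}$ has constant term $1$, $\langle\mathbf x_{s,t},f \mathbin{\sqcup\!\sqcup} g\rangle=\langle\mathbf x_{s,t},f\rangle\langle\mathbf x_{s,t},g\rangle$ for all $f,g\in T(V)$, $\mathbf x_{s,t}\otimes\mathbf x_{t,u}=\mathbf x_{s,u}$ for $s\le t\le u$, the path $t\mapsto\mathbf x_{0,t}$ is continuous, and $\max_{1\le m\le p}\sup_D\big(\sum_{t_i\in D}|\mathbf x^m_{t_i,t_{i+1}}|^{p/m}\big)^{1/p}<\infty$, where $D$ runs over the dissections of $[0,T]$. A continuous path $z:[0,L]\to T((V))$ is *tree-like* if $z=\psi\circ\varphi$ for a continuous map $\varphi$ from $[0,L]$ to an $\mathbb R$-tree with $\varphi(0)=\varphi(L)$ and some map $\psi$ from that tree to $T((V))$. Two rough paths $\mathbf x,\mathbf y$ are identified if the concatenation of $t\mapsto\mathbf x_{0,t}$ with the time-reversal of $t\mapsto\mathbf y_{0,t}$ (appending its multiplicative increments) is tree-like. The quotient $\mathcal R^w_p(V)$ is the space of *unparametrised* weakly geometric $p$-rough paths; $\mathbf X\mapsto\mathbf X_{0,T}\in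 T((V))$ is well defined on it, and it carries the topology induced by this map and its Borel $\sigma$-algebra. For $\tau_1,\dots,\tau_k\in[d]^*$ let $P(\tau_1,\dots,\tau_k)$ be the disjoint union of $k$ mutually incomparable chains, the $j$-th being the set of positions of $\tau_j$ (so all indices are treated as distinct). $\mathrm{Orp}(\tau_1,\dots,\tau_k)$ is the set of *ordered partitions* of this poset $P$, i.e. of the partitions of $P$ of the form $\ker f=\{f^{-1}(u)\ne\emptyset\}$ with $f:P\to\mathbb N$ order-preserving. For $\mathbf a\in\mathrm{Orp}(\tau_1,\dots,\tau_k)$, $|\mathbf a|$ is its number of blocks and $\mathbf a!$ is the number of order-preserving $f:P\to\{1,\dots,|\mathbf a|\}$ with $\ker f=\mathbf a$. For a block $a_i$, $a_i^j$ denotes the tuple of entries of $\tau_j$ at the positions belonging to $a_i$. **Theorem.** Let $p\ge1$ and let $\mathbf X$ be an $\mathcal R^w_p(V)$-valued random variable with $\mathbb E|\langle\mathbf X_{0,T},f\rangle|<\infty$ for every $f\in T(V)$. Put $\mu_{\mathbf X}=\mathbb E[\mathbf X_{0,T}]$ (coordinatewise) and $\kappa_{\mathbf X}=\log\mu_{\mathbf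 X}$. For $\mathbf a=\{a_1,\dots,a_n\}\in\mathrm{Orp}(\tau_1,\dots,\tau_k)$ put $\mu_{\mathbf X}(\mathbf a)=\prod_{i=1}^{n}\mathbb E\big[\prod_{j:\,a_i^j\neq\emptyset}\langle\mathbf X_{0,T},e_{a_i^j}\rangle\big]$, and for $\mathbf a=\{a_1,\dots,a_n\}\in\mathrm{Orp}(\tau)$ put $\kappa_{\mathbf X}(\mathbf a)=\prod_{i=1}^{n}\langle\kappa_{\mathbf X},e_{a_i}\rangle$. Then: 1. For all $k$ and $\tau_1,\dots,\tau_k\in[d]^*$, $$\langle\kappa_{\mathbf X},e_{\tau_1} \mathbin{\sqcup\!\sqcup} \cdots \mathbin{\sqcup\!\sqcup} e_{\tau_k}\rangle=\sum_{\mathbf a\in\mathrm{Orp}(\tau_1,\dots,\tau_k)}(-1)^{|\mathbf a|-1}\frac{\mathbf a!}{|\mathbf a|}\,\mu_{\mathbf X}(\mathbf a)$$ (if all $\tau_j$ are empty, the right-hand side is read as $0$). 2. For all $\tau\in[d]^*$, $$\langle\mu_{\mathbf X},e_\tau\rangle=\sum_{\mathbf a\in\mathrm{Orp}(\tau)}\frac1{|\mathbf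 a|!}\,\kappa_{\mathbf X}(\mathbf a).$$ 3. For $I\subseteq\{1,\dots,d\}$ let $I^*$ be the set of all tuples, including the empty one, with entries in $I$, and let $\mathbf X|_I=(\langle\mathbf X_{0,T},e_\tau\rangle)_{\tau\in I^*}$. Let $I,J\subseteq\{1,\dots,d\}$ and suppose that the joint law of $(\mathbf X|_I,\mathbf X|_J)$ is characterised by the mixed moments $\mathbb E[\langle\mathbf X_{0,T},e_{\tau_1}\rangle\langle\mathbf X_{0,T},e_{\tau_2}\rangle]$, $\tau_1\in I^*$, $\tau_2\in J^*$; that is, whenever a random pair $(\mathbf Y,\mathbf Z)$ in $\mathcal R^w_p(V)\times\mathcal R^w_p(V)$ satisfies, for all $\tau_1\in I^*,\tau_2\in J^*$, that $\langle\mathbf Y_{0,T},e_{\tau_1}\rangle\langle\mathbf Z_{0,T},e_{\tau_2}\rangle$ is integrable with mean $\mathbb E[\langle\mathbf X_{0,T},e_{\tau_1}\rangle\langle\mathbf X_{0,T},e_{\tau_2}\rangle]$, then $(\mathbf Y|_I,\mathbf Z|_J)$ has the same law as $(\mathbf X|_I,\mathbf X|_J)$. Then $\mathbf X|_I$ and $\mathbf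 X|_J$ are independent if and only if $$\langle\kappa_{\mathbf X},e_{\tau_1} \mathbin{\sqcup\!\sqcup} e_{\tau_2}\rangle=0\quad\text{for all non-empty }\tau_1\in I^*,\ \tau_2\in J^*.$$ -/

import Mathlib

open MeasureTheory ProbabilityTheory Set
open scoped ENNReal

noncomputable section

namespace SigCumulant

/-! ### Tensors, in coordinates with respect to the basis `e_τ` -/

/-- `[d]*`: tuples of arbitrary (possibly zero) length with entries in `[d]`. -/
abbrev Word (d : ℕ) := List (Fin d)

/-- `T((V)) = ∏ₘ V^{⊗m}`: a series is the family of its coordinates `x τ = ⟨x, e_τ⟩`. -/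
def TensorSeries (d : ℕ) : Type := Word d → ℝ

/-- `T(V) = ⨁ₘ V^{⊗m}`: finite linear combinations of the `e_τ`. -/
abbrev TensorPoly (d : ℕ) := Word d →₀ ℝ

/-- The basis element `e_τ` of `T(V)`. -/
def basisElem {d : ℕ} (τ : Word d) : TensorPoly d := Finsupp.single τ 1

/-- The pairing `⟨x, f⟩ = ∑_τ x_τ f_τ`. -/
def pairing {d : ℕ} (x : TensorSeries d) (f : TensorPoly d) : ℝ :=
  f.sum fun τ c => x τ * c

namespace TensorSeries

variable {d : ℕ}

instance : AddCommGroup (TensorSeries d) := inferInstanceAs (AddCommGroup (Word d → ℝ))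

/-- The tensor product on `T((V))`: since `e_u ⊗ e_v = e_{uv}`, the coordinate of `x ⊗ y` at `w`
is the sum of `x_u y_v` over all `|w| + 1` ways to cut `w = uv`. -/
instance : Mul (TensorSeries d) :=
  ⟨fun x y w => ∑ i ∈ Finset.range (w.length + 1), x (w.take i) * y (w.drop i)⟩

instance : One (TensorSeries d) := ⟨fun w => if w = [] then 1 else 0⟩

theorem add_apply (x y : TensorSeries d) (w : Word d) : (x + y) w = x w + y w := rfl
theorem sub_apply (x y : TensorSeries d) (w : Word d) : (x - y) w = x w - y w := rfl
theorem zero_apply (w : Word d) : (0 : TensorSeries d) w = 0 := rfl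
theorem one_apply (w : Word d) : (1 : TensorSeries d) w = if w = [] then 1 else 0 := rfl
theorem mul_apply (x y : TensorSeries d) (w : Word d) :
    (x * y) w = ∑ i ∈ Finset.range (w.length + 1), x (w.take i) * y (w.drop i) := rfl

protected theorem mul_assoc (x y z : TensorSeries d) : x * y * z = x * (y * z) := by
  funext w
  simp only [mul_apply, Finset.sum_mul, Finset.mul_sum]
  rw [Finset.sum_sigma', Finset.sum_sigma']
  refine Finset.sum_bij' (fun q _ => ⟨q.2, q.1 - q.2⟩) (fun q _ => ⟨q.1 + q.2, q.1⟩)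
    ?_ ?_ ?_ ?_ ?_
  · rintro ⟨i, j⟩ h
    simp only [Finset.mem_sigma, Finset.mem_range, List.length_take, List.length_drop] at h ⊢
    omega
  · rintro ⟨i, j⟩ h
    simp only [Finset.mem_sigma, Finset.mem_range, List.length_take, List.length_drop] at h ⊢
    omega
  · rintro ⟨i, j⟩ h
    simp only [Finset.mem_sigma, Finset.mem_range, List.length_take] at h
    have : j + (i - j) = i := by omega
    simp [this]
  · rintro ⟨i, j⟩ h
    simp
  · rintro ⟨i, j⟩ h
    simp only [Finset.mem_sigma, Finset.mem_range, List.length_take] at h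
    have h1 : j + (i - j) = i := by omega
    have h2 : min j i = j := by omega
    simp only [List.take_take, List.drop_drop, List.drop_take, h1, h2, mul_assoc]

protected theorem one_mul (x : TensorSeries d) : 1 * x = x := by
  funext w
  rw [mul_apply, Finset.sum_eq_single 0]
  · simp [one_apply]
  · intro i hi h0
    have hi' := Finset.mem_range.1 hi
    have : w.take i ≠ [] := by
      intro h
      have := congrArg List.length h
      simp only [List.length_take, List.length_nil] at this
      omega
    simp [one_apply, this]
  · simp

protected theorem mul_one (x : TensorSeries d) : x * 1 = x := by
  funext w
  rw [mul_apply, Finset.sum_eq_single w.length]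
  · simp [one_apply]
  · intro i hi h0
    have hi' := Finset.mem_range.1 hi
    have : w.drop i ≠ [] := by
      intro h
      have := congrArg List.length h
      simp only [List.length_drop, List.length_nil] at this
      omega
    simp [one_apply, this]
  · simp

instance : Ring (TensorSeries d) :=
  { (inferInstance : AddCommGroup (TensorSeries d)) with
    mul := (· * ·)
    one := 1
    mul_assoc := TensorSeries.mul_assoc
    one_mul := TensorSeries.one_mul
    mul_one := TensorSeries.mul_one
    left_distrib := fun x y z => by
      funext w; simp only [mul_apply, add_apply, mul_add, Finset.sum_add_distrib]
    right_distrib := fun x y z => by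
      funext w; simp only [mul_apply, add_apply, add_mul, Finset.sum_add_distrib]
    zero_mul := fun x => by
      funext w; simp [mul_apply, zero_apply]
    mul_zero := fun x => by
      funext w; simp [mul_apply, zero_apply] }

/-- If `x` has no constant term, then `x^{⊗n}` starts at level `n`. -/
theorem pow_apply_eq_zero (x : TensorSeries d) (hx : x [] = 0) (n : ℕ) (w : Word d)
    (h : w.length < n) : (x ^ n) w = 0 := by
  induction n generalizing w with
  | zero => omega
  | succ n ih =>
    rw [pow_succ, mul_apply]
    refine Finset.sum_eq_zero fun i hi => ?_
    have hi' := Finset.mem_range.1 hi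
    rcases Nat.lt_or_ge i w.length with hlt | hge
    · rw [ih (w.take i) (by simp only [List.length_take]; omega), zero_mul]
    · rw [List.drop_eq_nil_of_le hge, hx, mul_zero]

/-- The tensor logarithm `log x = ∑_{n ≥ 1} (-1)^{n-1}/n (x - 1)^{⊗n}` of a series with constant
term `1`. At the coordinate `w` the terms with `n > |w|` vanish by `pow_apply_eq_zero`, so the sum
is cut there. -/
def log (x : TensorSeries d) : TensorSeries d := fun w =>
  ∑ n ∈ Finset.Icc 1 w.length, ((-1 : ℝ) ^ (n + 1) / (n : ℝ)) * ((x - 1) ^ n) w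

/-- A norm of the level `x^m ∈ V^{⊗m}` (the `ℓ¹` norm of the coordinates; on a finite-dimensional
space all norms are equivalent). -/
def levelNorm (m : ℕ) (x : TensorSeries d) : ℝ := ∑ i : Fin m → Fin d, |x (List.ofFn i)|

/-- `‖x‖_c = ∑_n ‖x^n‖ c^n`, with value `∞` allowed; `E(V)` is the set of all `x` for which this
is finite for every `c > 0`. -/
def weightedNorm (c : ℝ) (x : TensorSeries d) : ℝ≥0∞ :=
  ∑' n : ℕ, ENNReal.ofReal (levelNorm n x * c ^ n)

theorem levelNorm_nonneg (m : ℕ) (x : TensorSeries d) : 0 ≤ levelNorm m x :=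
  Finset.sum_nonneg fun _ _ => abs_nonneg _

theorem weightedNorm_mono {c c' : ℝ} (hc : 0 ≤ c) (h : c ≤ c') (x : TensorSeries d) :
    weightedNorm c x ≤ weightedNorm c' x :=
  ENNReal.tsum_le_tsum fun n => ENNReal.ofReal_le_ofReal
    (mul_le_mul_of_nonneg_left (pow_le_pow_left₀ hc h n) (levelNorm_nonneg n x))

/-- The topology defined by the family of norms `‖·‖_c`, `c > 0`. On `E(V)` it is the usual locally
convex topology, and `E(V)` is open and closed for it. -/
instance : TopologicalSpace (TensorSeries d) where
  IsOpen U := ∀ x ∈ U, ∃ c : ℝ, 0 < c ∧ ∃ ε : ℝ≥0∞, 0 < ε ∧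
    ∀ y, weightedNorm c (y - x) < ε → y ∈ U
  isOpen_univ := fun _ _ => ⟨1, one_pos, 1, one_pos, fun _ _ => trivial⟩
  isOpen_inter := by
    rintro U V hU hV x ⟨hxU, hxV⟩
    obtain ⟨c, hc, ε, hε, h⟩ := hU x hxU
    obtain ⟨c', hc', ε', hε', h'⟩ := hV x hxV
    refine ⟨max c c', lt_max_of_lt_left hc, min ε ε', lt_min hε hε', fun y hy => ⟨?_, ?_⟩⟩
    · exact h y ((weightedNorm_mono hc.le (le_max_left _ _) _).trans_lt
        (hy.trans_le (min_le_left _ _)))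
    · exact h' y ((weightedNorm_mono hc'.le (le_max_right _ _) _).trans_lt
        (hy.trans_le (min_le_right _ _)))
  isOpen_sUnion := by
    rintro S hS x ⟨U, hU, hxU⟩
    obtain ⟨c, hc, ε, hε, h⟩ := hS U hU x hxU
    exact ⟨c, hc, ε, hε, fun y hy => ⟨U, hU, h y hy⟩⟩

end TensorSeries

/-! ### The shuffle product -/

/-- All shuffles of two tuples, listed with multiplicity (the entries count as distinct). -/
def shuffles {α : Type*} : List α → List α → List (List α)
  | [], v => [v]
  | a :: u, [] => [a :: u]
  | a :: u, b :: v =>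
    (shuffles u (b :: v)).map (a :: ·) ++ (shuffles (a :: u) v).map (b :: ·)
termination_by u v => u.length + v.length

/-- The shuffle product on `T(V)`: the bilinear extension of `e_u ⧢ e_v = ∑_{w ∈ Sh(u,v)} e_w`. -/
def shuffle {d : ℕ} (f g : TensorPoly d) : TensorPoly d :=
  f.sum fun u a => g.sum fun v b => (a * b) • ((shuffles u v).map basisElem).sum

/-- `e_{τ₁} ⧢ ⋯ ⧢ e_{τₖ}` (for `k = 0` this is the unit `e_∅`). -/
def shuffleWords {d k : ℕ} (τ : Fin k → Word d) : TensorPoly d :=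
  (List.ofFn fun j => basisElem (τ j)).foldr shuffle (basisElem [])

/-! ### Rough paths -/

/-- `max_{1 ≤ m ≤ p} sup_D (∑_{tᵢ ∈ D} |x^m_{tᵢ,tᵢ₊₁}|^{p/m})^{1/p}`, the supremum being over all
dissections `t₀ < ⋯ < tₙ` in `[0,T]`. -/
def pVariation {d : ℕ} (p T : ℝ) (x : ℝ → ℝ → TensorSeries d) : ℝ≥0∞ :=
  ⨆ (m : ℕ) (_ : 1 ≤ m ∧ (m : ℝ) ≤ p), ⨆ (n : ℕ) (t : Fin (n + 1) → Icc (0 : ℝ) T)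
    (_ : StrictMono t),
      (∑ i : Fin n, ENNReal.ofReal
        ((TensorSeries.levelNorm m (x (t i.castSucc) (t i.succ))) ^ (p / (m : ℝ)))) ^ (1 / p)

/-- A weakly geometric `p`-rough path on some interval `[0,T]`. Only the values `x_{s,t}` with
`0 ≤ s ≤ t ≤ T` matter. The unit condition excludes the zero map (the shuffle identity alone allows
the constant term to be `0`); together with `chen` it gives `x_{s,s} = 1`. -/
structure RoughPath (d : ℕ) (p : ℝ) where
  T : ℝ
  T_pos : 0 < T
  val : ℝ → ℝ → TensorSeries d
  unit : ∀ s t, 0 ≤ s → s ≤ t → t ≤ T → val s t [] = 1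
  shuffle_mul : ∀ s t, 0 ≤ s → s ≤ t → t ≤ T → ∀ f g : TensorPoly d,
    pairing (val s t) (shuffle f g) = pairing (val s t) f * pairing (val s t) g
  chen : ∀ s t u, 0 ≤ s → s ≤ t → t ≤ u → u ≤ T → val s t * val t u = val s u
  continuous : ContinuousOn (fun t => val 0 t) (Icc 0 T)
  pVariation_lt_top : pVariation p T val < ∞

/-- `ℝ`-trees: any two points are joined by a geodesic, and every arc (injective continuous path)
between them has the same image as that geodesic. -/
def IsRTree (M : Type*) [MetricSpace M] : Prop :=
  ∀ x y : M, ∃ γ : ℝ → M, γ 0 = x ∧ γ (dist x y) = y ∧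
    (∀ s ∈ Icc 0 (dist x y), ∀ t ∈ Icc 0 (dist x y), dist (γ s) (γ t) = |s - t|) ∧
    ∀ f : ℝ → M, ContinuousOn f (Icc 0 1) → InjOn f (Icc 0 1) → f 0 = x → f 1 = y →
      f '' Icc 0 1 = γ '' Icc 0 (dist x y)

/-- A path `z : [0,L] → E` is tree-like if it is continuous and factors as `z = ψ ∘ φ` through an
`ℝ`-tree, with `φ` continuous and `φ 0 = φ L` (no condition on the map `ψ`). -/
def IsTreeLike {E : Type*} [TopologicalSpace E] (L : ℝ) (z : ℝ → E) : Prop :=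
  ContinuousOn z (Icc 0 L) ∧
  ∃ (M : Type) (_ : MetricSpace M) (φ : ℝ → M) (ψ : M → E), IsRTree M ∧
    ContinuousOn φ (Icc 0 L) ∧ φ 0 = φ L ∧ ∀ t ∈ Icc 0 L, z t = ψ (φ t)

/-- The time-reversal of a path on `[0,T]`. -/
def reversal {E : Type*} (T : ℝ) (z : ℝ → E) : ℝ → E := fun t => z (T - t)

/-- The concatenation of a path `z` on `[0,T]` with a path `z'` starting at time `0`, in a
multiplicative setting: after time `T` the increments `z'(0)⁻¹ z'(s)` are appended to `z(T)`. -/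
def concat {E : Type*} [Ring E] (T : ℝ) (z z' : ℝ → E) : ℝ → E := fun t =>
  if t < T then z t else z T * Ring.inverse (z' 0) * z' (t - T)

namespace RoughPath

variable {d : ℕ} {p : ℝ}

/-- The signature `x_{0,T}`. -/
def signature (x : RoughPath d p) : TensorSeries d := x.val 0 x.T

/-- Tree-like equivalence: `t ↦ x_{0,t}`, followed by the reversal of `t ↦ y_{0,t}`, is
tree-like. -/
def TreeLikeEquiv (x y : RoughPath d p) : Prop :=
  IsTreeLike (x.T + y.T) (concat x.T (x.val 0) (reversal y.T (y.val 0)))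

theorem val_zero_zero (x : RoughPath d p) : x.val 0 0 = 1 := by
  have hc := x.chen 0 0 0 le_rfl le_rfl le_rfl x.T_pos.le
  have hu := x.unit 0 0 le_rfl le_rfl x.T_pos.le
  set a := x.val 0 0 with ha
  have h0 : (a - 1) [] = 0 := by
    rw [TensorSeries.sub_apply, hu, TensorSeries.one_apply]; simp
  have hi : (1 - a) * (1 - a) = 1 - a := by
    have : (1 - a) * (1 - a) = 1 - a - a + a * a := by noncomm_ring
    rw [this, hc]; abel
  have h0' : (1 - a) [] = 0 := by
    rw [TensorSeries.sub_apply, hu, TensorSeries.one_apply]; simp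
  have hp : ∀ n : ℕ, (1 - a) ^ (n + 1) = 1 - a := by
    intro n
    induction n with
    | zero => simp
    | succ n ih => rw [pow_succ, ih, hi]
  have hz : (1 - a) = 0 := by
    funext w
    rw [← hp w.length, TensorSeries.pow_apply_eq_zero _ h0' _ _ (Nat.lt_succ_self _)]
    rfl
  exact (sub_eq_zero.1 hz).symm

/-- The signature is an invariant of tree-like equivalence. -/
theorem TreeLikeEquiv.signature_eq {x y : RoughPath d p} (h : TreeLikeEquiv x y) :
    x.signature = y.signature := by
  obtain ⟨-, M, _, φ, ψ, -, -, h0, hz⟩ := h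
  have hx := x.T_pos
  have hy := y.T_pos
  have e0 := hz 0 ⟨le_rfl, by linarith⟩
  have e1 := hz (x.T + y.T) ⟨by linarith, le_rfl⟩
  rw [← h0, ← e0] at e1
  simp only [concat, reversal, hx, if_true, not_lt.2 (le_add_of_nonneg_right hy.le), if_false,
    add_sub_cancel_left, sub_self, sub_zero, val_zero_zero, mul_one] at e1
  have hu : IsUnit (y.val 0 y.T) := by
    by_contra hn
    rw [Ring.inverse_non_unit _ hn, mul_zero] at e1
    have := congrFun e1 []
    rw [TensorSeries.one_apply, TensorSeries.zero_apply] at this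
    simp at this
  have := congrArg (· * y.val 0 y.T) e1
  simp only [mul_assoc, Ring.inverse_mul_cancel _ hu, mul_one, one_mul] at this
  exact this

end RoughPath

/-- The space of unparametrised weakly geometric `p`-rough paths: the quotient of the rough paths
by tree-like equivalence. -/
def UnparamRoughPath (d : ℕ) (p : ℝ) : Type := Quot (RoughPath.TreeLikeEquiv (d := d) (p := p))

namespace UnparamRoughPath

variable {d : ℕ} {p : ℝ}

/-- `X ↦ X_{0,T}`. -/
def signature : UnparamRoughPath d p → TensorSeries d :=
  Quot.lift RoughPath.signature fun _ _ h => h.signature_eq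

/-- The topology induced by `X ↦ X_{0,T}`. -/
instance : TopologicalSpace (UnparamRoughPath d p) :=
  TopologicalSpace.induced signature inferInstance

instance : MeasurableSpace (UnparamRoughPath d p) := borel _

instance : BorelSpace (UnparamRoughPath d p) := ⟨rfl⟩

end UnparamRoughPath

/-! ### Ordered partitions -/

section OrderedPartitions

variable {P : Type*} [Fintype P] [DecidableEq P]

/-- `a = ker f`: two points lie in a common block of `a` exactly if `f` agrees on them. -/
def IsKer {β : Type*} (a : Finpartition (Finset.univ : Finset P)) (f : P → β) : Prop :=
  ∀ x y, f x = f y ↔ ∃ b ∈ a.parts, x ∈ b ∧ y ∈ b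

open scoped Classical in
/-- The ordered partitions of a finite poset: the kernels of order-preserving maps to `ℕ`. -/
def Orp (P : Type*) [Fintype P] [DecidableEq P] [PartialOrder P] :
    Finset (Finpartition (Finset.univ : Finset P)) :=
  Finset.univ.filter fun a => ∃ f : P →o ℕ, IsKer a f

/-- The number of blocks `|a|`. -/
def numBlocks (a : Finpartition (Finset.univ : Finset P)) : ℕ := a.parts.card

/-- `a! = #{f ∈ Hom(P, [|a|]) | ker f = a}`. -/
def factorial [PartialOrder P] (a : Finpartition (Finset.univ : Finset P)) : ℕ :=
  Nat.card {f : P →o Fin (numBlocks a) // IsKer a f}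

end OrderedPartitions

/-- The poset `{τ₁} ∪ ⋯ ∪ {τₖ}`: the disjoint union of `k` mutually incomparable chains, the `j`-th
consisting of the positions of `τⱼ` (so that all indices count as distinct). The order is the
componentwise one on a sigma type. -/
abbrev WordPoset {d k : ℕ} (τ : Fin k → Word d) := Σ j : Fin k, Fin (τ j).length

/-- `aᵢʲ = τⱼ ∩ aᵢ`: the tuple of the entries of `τⱼ` at the positions in the block `b`. -/
def subword {d k : ℕ} (τ : Fin k → Word d) (b : Finset (WordPoset τ)) (j : Fin k) : Word d :=
  ((List.finRange (τ j).length).filter fun i => (⟨j, i⟩ : WordPoset τ) ∈ b).map (τ j).get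

/-! ### Signature moments and cumulants -/

section Moments

variable {Ω : Type*} [MeasurableSpace Ω] {d : ℕ} {p : ℝ}

/-- The signature moments `μ_X = 𝔼[X_{0,T}]`. -/
def sigMoment (μ : Measure Ω) (X : Ω → UnparamRoughPath d p) : TensorSeries d :=
  fun w => ∫ ω, (X ω).signature w ∂μ

/-- The signature cumulant `κ_X = log 𝔼[X_{0,T}]`. -/
def sigCumulant (μ : Measure Ω) (X : Ω → UnparamRoughPath d p) : TensorSeries d :=
  (sigMoment μ X).log

/-- The generalised moment `μ_X(a) = ∏ᵢ 𝔼[∏ⱼ ⟨X_{0,T}, e_{aᵢʲ}⟩]`, with `j` running over the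
non-empty `aᵢʲ`. -/
def genMoment (μ : Measure Ω) (X : Ω → UnparamRoughPath d p) {k : ℕ} (τ : Fin k → Word d)
    (a : Finpartition (Finset.univ : Finset (WordPoset τ))) : ℝ :=
  ∏ b ∈ a.parts, ∫ ω, ∏ j with subword τ b j ≠ [], (X ω).signature (subword τ b j) ∂μ

/-- The generalised signature cumulant `κ_X(a) = ∏ᵢ ⟨κ_X, e_{aᵢ}⟩` of a partition of one tuple. -/
def genCumulant (μ : Measure Ω) (X : Ω → UnparamRoughPath d p) (τ : Word d)
    (a : Finpartition (Finset.univ : Finset (WordPoset fun _ : Fin 1 => τ))) : ℝ :=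
  ∏ b ∈ a.parts, pairing (sigCumulant μ X) (basisElem (subword (fun _ : Fin 1 => τ) b 0))

/-- The tuples with entries in `I` (including the empty one). -/
def wordsIn (I : Set (Fin d)) : Set (Word d) := {w | ∀ i ∈ w, i ∈ I}

/-- `X|_I = (⟨X_{0,T}, e_τ⟩)_τ` with `τ` running over the tuples with entries in `I` (the empty
tuple contributes the constant `1`). -/
def restrict (I : Set (Fin d)) (x : UnparamRoughPath d p) : wordsIn I → ℝ :=
  fun τ => x.signature τ

/-- The joint law of `(X|_I, X|_J)` is characterised by the mixed moments
`𝔼[⟨X_{0,T}, e_{τ₁}⟩ ⟨X_{0,T}, e_{τ₂}⟩]`, `τ₁` and `τ₂` with entries in `I` and `J`: whenever a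
random pair of unparametrised rough paths, with law `ν`, has these same mixed moments, its
restrictions to `I` and `J` have the same joint law. -/
def CharacterisedByMixedMoments (μ : Measure Ω) (X : Ω → UnparamRoughPath d p)
    (I J : Set (Fin d)) : Prop :=
  ∀ ν : Measure (UnparamRoughPath d p × UnparamRoughPath d p), IsProbabilityMeasure ν →
    (∀ τ₁ ∈ wordsIn I, ∀ τ₂ ∈ wordsIn J,
      Integrable (fun y => y.1.signature τ₁ * y.2.signature τ₂) ν ∧
      ∫ y, y.1.signature τ₁ * y.2.signature τ₂ ∂ν =
        ∫ ω, (X ω).signature τ₁ * (X ω).signature τ₂ ∂μ) →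
    ν.map (fun y => (restrict I y.1, restrict J y.2)) =
      μ.map (fun ω => (restrict I (X ω), restrict J (X ω)))

end Moments

end SigCumulant

end

open SigCumulant

namespace SigCumulant

/-! ### Sums over shuffles -/

/-! Deconcatenation is a morphism for the shuffle product (`shuffleSum_cutSum`). Hence pairing `x ^
n` with a shuffle of words gives a sum over all ways to factor these words simultaneously into `n`
tuples of possibly empty words (`pairing_pow_shuffleWords`). Such a factorisation is the same as an
order-preserving map from the poset of positions to `Fin n` (`sum_factorisations`). If `x` has no
constant term, only surjective maps contribute, and grouping them by their kernels gives a sum over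
ordered partitions with `n` blocks, weighted by `factorial a` (`pairing_pow_eq_sum_orp`).

The first formula inserts this into the logarithm series at `x - 1`. The expected signature turns
products of coordinates into pairings with shuffles, because each signature is multiplicative for
the shuffle product (`genMoment_eq`). The second formula inserts it into `exp (log x) = x`; a chain
has `factorial a = 1`.

For the third claim, vanishing of the mixed cumulants says that `log x` is primitive when tested on
pairs of words from `I` and `J`: its coproduct acts there as `log x ⊗ 1 + 1 ⊗ log x`. These two
summands commute, so exponentiating shows that the mixed moments factorise. Conversely, the lowest
mixed cumulant is exactly the failure of a moment to factorise (`shuffleSum_eq_mul_add`), so an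
induction on total length gives vanishing (`mixed_log_eq_zero_iff`). Factorised mixed moments are
those of two independent copies of `X`, and the moment characterisation then yields independence
(`indepFun_of_mixed_moments`). -/

/-- The sum of `F` over all shuffles of `u` and `v`. -/
def shuffleSum {α : Type*} (u v : List α) (F : List α → ℝ) : ℝ := ((shuffles u v).map F).sum

section ShuffleSum

variable {α : Type*}

@[simp] theorem shuffleSum_nil_left (v : List α) (F : List α → ℝ) : shuffleSum [] v F = F v := by
  simp [shuffleSum, shuffles]

@[simp] theorem shuffleSum_nil_right (u : List α) (F : List α → ℝ) : shuffleSum u [] F = F u := by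
  cases u <;> simp [shuffleSum, shuffles]

theorem shuffleSum_cons_cons (a : α) (u : List α) (b : α) (v : List α) (F : List α → ℝ) :
    shuffleSum (a :: u) (b :: v) F =
      shuffleSum u (b :: v) (fun w => F (a :: w)) + shuffleSum (a :: u) v (fun w => F (b :: w)) := by
  simp [shuffleSum, shuffles, Function.comp_def]

theorem shuffleSum_add (u v : List α) (F G : List α → ℝ) :
    shuffleSum u v (fun w => F w + G w) = shuffleSum u v F + shuffleSum u v G := by
  simp [shuffleSum, List.sum_map_add]

theorem shuffleSum_mul_left (u v : List α) (c : ℝ) (F : List α → ℝ) :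
    shuffleSum u v (fun w => c * F w) = c * shuffleSum u v F := by
  simp [shuffleSum, List.sum_map_mul_left]

theorem shuffleSum_mul_right (u v : List α) (c : ℝ) (F : List α → ℝ) :
    shuffleSum u v (fun w => F w * c) = shuffleSum u v F * c := by
  simp [shuffleSum, List.sum_map_mul_right]

theorem shuffleSum_zero (u v : List α) : shuffleSum u v (fun _ => 0) = 0 := by
  simp [shuffleSum]

theorem shuffleSum_sum {ι : Type*} (u v : List α) (s : Finset ι) (F : ι → List α → ℝ) :
    shuffleSum u v (fun w => ∑ i ∈ s, F i w) = ∑ i ∈ s, shuffleSum u v (F i) := by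
  classical
  induction s using Finset.induction_on with
  | empty => simp [shuffleSum_zero]
  | insert a s ha ih => simp [Finset.sum_insert ha, shuffleSum_add, ih]

theorem length_of_mem_shuffles (u v w : List α) (h : w ∈ shuffles u v) :
    w.length = u.length + v.length := by
  induction u, v using shuffles.induct generalizing w with
  | case1 v => simp_all [shuffles]
  | case2 a u => simp_all [shuffles]
  | case3 a u b v ih1 ih2 =>
    simp only [shuffles, List.mem_append, List.mem_map] at h
    rcases h with ⟨w', h', rfl⟩ | ⟨w', h', rfl⟩
    · have := ih1 _ h'; simp at *; omega
    · have := ih2 _ h'; simp at *; omega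

theorem shuffleSum_congr {u v : List α} {F G : List α → ℝ}
    (h : ∀ w, w.length = u.length + v.length → F w = G w) : shuffleSum u v F = shuffleSum u v G := by
  unfold shuffleSum
  congr 1
  exact List.map_congr_left fun w hw => h w (length_of_mem_shuffles u v w hw)

/-- The sum of `F` over all ways to cut a word into two. -/
def cutSum (F : List α → List α → ℝ) (w : List α) : ℝ :=
  ∑ i ∈ Finset.range (w.length + 1), F (w.take i) (w.drop i)

theorem cutSum_cons (F : List α → List α → ℝ) (a : α) (w : List α) :
    cutSum F (a :: w) = cutSum (fun p q => F (a :: p) q) w + F [] (a :: w) := by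
  simp only [cutSum, List.length_cons]
  rw [Finset.sum_range_succ']
  simp

/-- Deconcatenation is a morphism for the shuffle product. -/
theorem shuffleSum_cutSum (u v : List α) (F : List α → List α → ℝ) :
    shuffleSum u v (cutSum F) =
      ∑ i ∈ Finset.range (u.length + 1), ∑ j ∈ Finset.range (v.length + 1),
        shuffleSum (u.take i) (v.take j)
          fun p => shuffleSum (u.drop i) (v.drop j) fun q => F p q := by
  induction u, v using shuffles.induct generalizing F with
  | case1 v => simp [cutSum]
  | case2 a u => simp [cutSum]
  | case3 a u b v ih1 ih2 =>
    -- Every shuffle starts with `a` or with `b`; a nonempty prefix of it absorbs that letter, so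
    -- the induction applies to `F` with the letter put in front of its first argument.
    have h1 := ih1 fun p q => F (a :: p) q
    have h2 := ih2 fun p q => F (b :: p) q
    rw [shuffleSum_cons_cons]
    simp only [cutSum_cons, shuffleSum_add]
    rw [h1, h2]
    simp only [List.length_cons]
    -- Isolating the cuts at `0` in either word leaves, on both sides, the same terms sorted by the
    -- first letter of the prefix shuffle.
    rw [Finset.sum_range_succ' _ (u.length + 1), Finset.sum_range_succ' _ (u.length + 1)]
    simp only [Finset.sum_range_succ' _ (v.length + 1)]
    simp only [List.take_succ_cons, List.take_zero, List.drop_succ_cons, List.drop_zero,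
      shuffleSum_cons_cons, shuffleSum_nil_left, shuffleSum_nil_right, Finset.sum_add_distrib]
    ring

end ShuffleSum

/-! ### Shuffles of several words -/

/-- The sum of `F` over all shuffles of a list of words. -/
def multiShuffleSum {α : Type*} : List (List α) → (List α → ℝ) → ℝ
  | [], F => F []
  | u :: L, F => multiShuffleSum L fun w => shuffleSum u w F

section MultiShuffleSum

variable {α : Type*}

theorem multiShuffleSum_sum {ι : Type*} (L : List (List α)) (s : Finset ι) (F : ι → List α → ℝ) :
    multiShuffleSum L (fun w => ∑ i ∈ s, F i w) = ∑ i ∈ s, multiShuffleSum L (F i) := by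
  induction L generalizing F with
  | nil => rfl
  | cons u L ih => simp only [multiShuffleSum, shuffleSum_sum, ih]

theorem multiShuffleSum_mul_left (L : List (List α)) (c : ℝ) (F : List α → ℝ) :
    multiShuffleSum L (fun w => c * F w) = c * multiShuffleSum L F := by
  induction L generalizing F with
  | nil => rfl
  | cons u L ih => simp only [multiShuffleSum, shuffleSum_mul_left, ih]

theorem multiShuffleSum_mul_right (L : List (List α)) (c : ℝ) (F : List α → ℝ) :
    multiShuffleSum L (fun w => F w * c) = multiShuffleSum L F * c := by
  simpa only [mul_comm] using multiShuffleSum_mul_left L c F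

theorem multiShuffleSum_congr {L : List (List α)} {F G : List α → ℝ}
    (h : ∀ w, w.length = (L.map List.length).sum → F w = G w) :
    multiShuffleSum L F = multiShuffleSum L G := by
  induction L generalizing F G with
  | nil => exact h [] rfl
  | cons u L ih =>
    refine ih fun w hw => shuffleSum_congr fun w' hw' => h w' ?_
    simp [hw', hw]

theorem shuffleSum_multiShuffleSum_comm (u v : List α) (L : List (List α))
    (F : List α → List α → ℝ) :
    shuffleSum u v (fun p => multiShuffleSum L fun q => F p q) =
      multiShuffleSum L fun q => shuffleSum u v fun p => F p q := by
  induction L generalizing F with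
  | nil => rfl
  | cons w L ih =>
    simp only [multiShuffleSum]
    rw [ih]
    congr 1
    funext q
    simp only [shuffleSum]
    induction shuffles u v with
    | nil => simp
    | cons a l ih => simp [ih, List.sum_map_add]

/-- The tuples of positions at which a tuple of words can be cut. -/
def cuts {k : ℕ} (τ : Fin k → List α) : Finset (Fin k → ℕ) :=
  Fintype.piFinset fun j => Finset.range ((τ j).length + 1)

theorem mem_cuts {k : ℕ} {τ : Fin k → List α} {c : Fin k → ℕ} :
    c ∈ cuts τ ↔ ∀ j, c j ≤ (τ j).length := by
  simp [cuts]

theorem sum_cuts_succ {k : ℕ} (τ : Fin (k + 1) → List α) (G : (Fin (k + 1) → ℕ) → ℝ) :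
    ∑ c ∈ cuts τ, G c = ∑ i ∈ Finset.range ((τ 0).length + 1),
      ∑ c ∈ cuts (fun j => τ j.succ), G (Fin.cons i c) := by
  rw [Finset.sum_sigma']
  refine Finset.sum_bij' (fun c _ => ⟨c 0, fun j => c j.succ⟩) (fun q _ => Fin.cons q.1 q.2)
    ?_ ?_ ?_ ?_ ?_
  · intro c hc
    rw [mem_cuts] at hc
    simp only [Finset.mem_sigma, Finset.mem_range, mem_cuts]
    exact ⟨Nat.lt_succ_of_le (hc 0), fun j => hc j.succ⟩
  · rintro ⟨i, c⟩ hc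
    simp only [Finset.mem_sigma, Finset.mem_range, mem_cuts] at hc ⊢
    intro j
    cases j using Fin.cases with
    | zero => exact Nat.lt_succ_iff.1 hc.1
    | succ j => exact hc.2 j
  · intro c hc
    funext j
    cases j using Fin.cases <;> rfl
  · rintro ⟨i, c⟩ hc
    rfl
  · intro c hc
    congr 1
    funext j
    cases j using Fin.cases <;> rfl

/-- Peeling off the first word applies the two-word rule, and the induction hypothesis is used for
`F` already averaged over the two halves of that word. Interchanging finite sums then separates
prefixes from suffixes. -/
theorem multiShuffleSum_cutSum {k : ℕ} (τ : Fin k → List α) (F : List α → List α → ℝ) :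
    multiShuffleSum (List.ofFn τ) (cutSum F) =
      ∑ c ∈ cuts τ, multiShuffleSum (List.ofFn fun j => (τ j).take (c j))
        fun p => multiShuffleSum (List.ofFn fun j => (τ j).drop (c j)) fun q => F p q := by
  induction k generalizing F with
  | zero => simp [cuts, multiShuffleSum, cutSum]
  | succ k ih =>
    rw [sum_cuts_succ]
    simp only [List.ofFn_succ, multiShuffleSum, Fin.cons_zero, Fin.cons_succ]
    simp only [shuffleSum_cutSum]
    rw [multiShuffleSum_sum]
    refine Finset.sum_congr rfl fun i _ => ?_
    have := ih (fun j => τ j.succ) fun p q =>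
      shuffleSum ((τ 0).take i) p fun p' => shuffleSum ((τ 0).drop i) q fun q' => F p' q'
    refine this.trans (Finset.sum_congr rfl fun c _ => ?_)
    simp only [shuffleSum_multiShuffleSum_comm]

end MultiShuffleSum

/-! ### Pairing with shuffles -/

variable {d : ℕ}

/-- The coordinate function of a series. -/
def coeff (x : TensorSeries d) : Word d → ℝ := fun w => x w

/-- The series with given coordinates. -/
def ofCoeff (f : Word d → ℝ) : TensorSeries d := f

theorem coeff_apply (x : TensorSeries d) (w : Word d) : coeff x w = x w := rfl

theorem coeff_mul (x y : TensorSeries d) :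
    coeff (x * y) = cutSum fun p q => coeff x p * coeff y q := rfl

theorem pairing_eq_linearCombination (x : TensorSeries d) (f : TensorPoly d) :
    pairing x f = Finsupp.linearCombination ℝ (coeff x) f := by
  simp only [pairing, Finsupp.linearCombination_apply, smul_eq_mul, mul_comm, coeff_apply]

@[simp] theorem pairing_basisElem (x : TensorSeries d) (w : Word d) :
    pairing x (basisElem w) = coeff x w := by
  simp [pairing, basisElem, coeff_apply]

theorem pairing_list_sum (x : TensorSeries d) (l : List (TensorPoly d)) :
    pairing x l.sum = (l.map (pairing x)).sum := by
  have : pairing x = Finsupp.linearCombination ℝ (coeff x) := by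
    funext f; exact pairing_eq_linearCombination x f
  rw [this, map_list_sum]

theorem pairing_smul (x : TensorSeries d) (c : ℝ) (f : TensorPoly d) :
    pairing x (c • f) = c * pairing x f := by
  simp [pairing_eq_linearCombination]

/-- The adjoint of shuffling with a fixed word, acting on series. Allowing an arbitrary polynomial
`g` is what lets the iterated product be unwound one word at a time. -/
theorem pairing_shuffle_basisElem (x : TensorSeries d) (u : Word d) (g : TensorPoly d) :
    pairing x (shuffle (basisElem u) g) = pairing (ofCoeff fun v => shuffleSum u v (coeff x)) g := by
  rw [shuffle, basisElem, Finsupp.sum_single_index (by simp)]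
  simp only [one_mul]
  rw [pairing_eq_linearCombination, Finsupp.sum, map_sum]
  unfold pairing Finsupp.sum
  refine Finset.sum_congr rfl fun v _ => ?_
  rw [← pairing_eq_linearCombination, pairing_smul, pairing_list_sum, mul_comm]
  simp [shuffleSum, Function.comp_def, ofCoeff]

theorem pairing_shuffle_basisElem_basisElem (x : TensorSeries d) (u v : Word d) :
    pairing x (shuffle (basisElem u) (basisElem v)) = shuffleSum u v (coeff x) := by
  rw [pairing_shuffle_basisElem, pairing_basisElem]
  rfl

theorem pairing_foldr_shuffle (L : List (Word d)) (x : TensorSeries d) :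
    pairing x ((L.map basisElem).foldr shuffle (basisElem [])) = multiShuffleSum L (coeff x) := by
  induction L generalizing x with
  | nil => simp [multiShuffleSum]
  | cons u L ih =>
    rw [List.map_cons, List.foldr_cons, pairing_shuffle_basisElem, ih]
    rfl

theorem pairing_shuffleWords {k : ℕ} (τ : Fin k → Word d) (x : TensorSeries d) :
    pairing x (shuffleWords τ) = multiShuffleSum (List.ofFn τ) (coeff x) := by
  rw [← pairing_foldr_shuffle, shuffleWords, List.map_ofFn]
  rfl

theorem pairing_mul_shuffleWords {k : ℕ} (τ : Fin k → Word d) (x y : TensorSeries d) :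
    pairing (x * y) (shuffleWords τ) =
      ∑ c ∈ cuts τ, pairing x (shuffleWords fun j => (τ j).take (c j)) *
        pairing y (shuffleWords fun j => (τ j).drop (c j)) := by
  simp only [pairing_shuffleWords, coeff_mul, multiShuffleSum_cutSum, multiShuffleSum_mul_left,
    multiShuffleSum_mul_right]

theorem shuffleSum_mul (u v : Word d) (x y : TensorSeries d) :
    shuffleSum u v (coeff (x * y)) =
      ∑ i ∈ Finset.range (u.length + 1), ∑ j ∈ Finset.range (v.length + 1),
        shuffleSum (u.take i) (v.take j) (coeff x) *
          shuffleSum (u.drop i) (v.drop j) (coeff y) := by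
  simp only [coeff_mul, shuffleSum_cutSum, shuffleSum_mul_left, shuffleSum_mul_right]

theorem pairing_one_shuffleWords {k : ℕ} (τ : Fin k → Word d) :
    pairing 1 (shuffleWords τ) = if τ = fun _ => [] then 1 else 0 := by
  rw [pairing_shuffleWords]
  split_ifs with h
  · subst h
    induction k with
    | zero => simp [multiShuffleSum, coeff_apply, TensorSeries.one_apply]
    | succ k ih =>
      rw [List.ofFn_succ, multiShuffleSum]
      simpa only [shuffleSum_nil_left] using ih
  -- Shuffling preserves total length, so no empty word occurs and the integrand vanishes; writing
  -- it as `0 * _` lets the constant be pulled out.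
  · rw [multiShuffleSum_congr (G := fun w => 0 * coeff (1 : TensorSeries d) w),
      multiShuffleSum_mul_left, zero_mul]
    intro w hw
    rw [zero_mul, coeff_apply, TensorSeries.one_apply, if_neg]
    rintro rfl
    apply h
    funext j
    simp only [List.length_nil, List.map_ofFn, List.sum_ofFn] at hw
    have := Finset.sum_eq_zero_iff.1 hw.symm j (Finset.mem_univ j)
    simpa using this

/-! ### Powers of a series and factorisations of words -/

/-- The ways to write a tuple of words as a product of `n` tuples of words. -/
def IsFactorisation {α : Type*} {k n : ℕ} (τ : Fin k → List α) (v : Fin n → Fin k → List α) :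
    Prop := ∀ j, (List.ofFn fun i => v i j).flatten = τ j

theorem finite_isFactorisation {k : ℕ} (n : ℕ) (τ : Fin k → Word d) :
    {v : Fin n → Fin k → Word d | IsFactorisation τ v}.Finite := by
  refine Set.Finite.subset (Set.Finite.pi' fun i : Fin n => Set.Finite.pi' fun j : Fin k =>
    List.finite_length_le (Fin d) (τ j).length) ?_
  intro v hv i j
  rw [Set.mem_ofPred_eq, ← hv j]
  exact (List.sublist_flatten_of_mem (by simp)).length_le

/-- The finset of factorisations of a tuple of words. -/
noncomputable def factorisations {k : ℕ} (n : ℕ) (τ : Fin k → Word d) :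
    Finset (Fin n → Fin k → Word d) := (finite_isFactorisation n τ).toFinset

theorem mem_factorisations {k n : ℕ} {τ : Fin k → Word d} {v : Fin n → Fin k → Word d} :
    v ∈ factorisations n τ ↔ IsFactorisation τ v := by simp [factorisations]

/-- Iterates the coproduct rule: a simultaneous cut splits off the first factor, and the remaining
suffixes are factored by induction. -/
theorem pairing_pow_shuffleWords {k : ℕ} (n : ℕ) (τ : Fin k → Word d) (x : TensorSeries d) :
    pairing (x ^ n) (shuffleWords τ) =
      ∑ v ∈ factorisations n τ, ∏ i, pairing x (shuffleWords (v i)) := by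
  induction n generalizing τ with
  | zero =>
    rw [pow_zero, pairing_one_shuffleWords]
    split_ifs with h
    · have : factorisations 0 τ = Finset.univ := by
        ext v
        simp only [mem_factorisations, IsFactorisation, h, List.ofFn_zero, List.flatten_nil,
          implies_true, Finset.mem_univ]
      simp [this]
    · have : factorisations 0 τ = ∅ := by
        ext v
        simp only [mem_factorisations, IsFactorisation, List.ofFn_zero, List.flatten_nil,
          Finset.notMem_empty, iff_false]
        exact fun h' => h (funext fun j => (h' j).symm)
      simp [this]
  | succ n ih =>
    rw [pow_succ', pairing_mul_shuffleWords]
    simp only [ih, Finset.mul_sum]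
    rw [Finset.sum_sigma']
    refine Finset.sum_bij'
      (fun q _ => Fin.cons (fun j => (τ j).take (q.1 j)) q.2)
      -- The cut positions are recovered as the lengths of the first factor.
      (fun v _ => ⟨fun j => (v 0 j).length, fun i => v i.succ⟩) ?_ ?_ ?_ ?_ ?_
    · rintro ⟨c, v⟩ h
      simp only [Finset.mem_sigma, mem_factorisations, mem_cuts] at h ⊢
      intro j
      have := h.2 j
      simp [List.ofFn_succ, this]
    · intro v hv
      simp only [Finset.mem_sigma, mem_factorisations, mem_cuts] at hv ⊢
      refine ⟨fun j => ?_, fun j => ?_⟩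
      · rw [← hv j, List.ofFn_succ]; simp
      · simp only [← hv j, List.ofFn_succ]; simp
    · rintro ⟨c, v⟩ h
      simp only [Finset.mem_sigma, mem_factorisations, mem_cuts] at h
      simp [h.1]
    · intro v hv
      simp only [mem_factorisations] at hv
      funext i
      cases i using Fin.cases with
      | zero =>
        funext j
        rw [Fin.cons_zero, ← hv j, List.ofFn_succ]; simp
      | succ i => rfl
    · rintro ⟨c, v⟩ h
      rw [Fin.prod_univ_succ]
      rfl

/-! ### Monotone labellings of words -/

section Labellings

/-- A list sorted by `g` is the concatenation of its level sets. Once an entry has label at least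
`n`, so have all later ones, which empties the filter below `n`. -/
theorem flatten_map_filter_range {β : Type*} (g : β → ℕ) (L : List β)
    (hL : L.Pairwise fun x y => g x ≤ g y) (n : ℕ) :
    ((List.range n).map fun i => L.filter fun x => g x = i).flatten =
      L.filter fun x => g x < n := by
  induction n with
  | zero => simp
  | succ n ih =>
    rw [List.range_succ, List.map_append, List.flatten_append, ih]
    simp only [List.map_cons, List.map_nil, List.flatten_cons, List.flatten_nil, List.append_nil]
    clear ih
    induction L with
    | nil => simp
    | cons x L ihL =>
      rw [List.pairwise_cons] at hL
      have ih := ihL hL.2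
      rcases lt_trichotomy (g x) n with h | h | h
      · simp [h, h.ne, ih, h.le]
      · have h0 : L.filter (fun y => g y < n) = [] := by
          rw [List.filter_eq_nil_iff]
          intro y hy
          have := hL.1 y hy
          simp; omega
        rw [h0, List.nil_append] at ih
        simp [h, h0, ih]
      · have h0 : L.filter (fun y => g y < n) = [] := by
          rw [List.filter_eq_nil_iff]
          intro y hy
          have := hL.1 y hy
          simp; omega
        rw [h0, List.nil_append] at ih
        simp [h.ne', h.not_gt, h.not_ge, h0, ih]

theorem flatten_ofFn_filter {β : Type*} {n : ℕ} (g : β → Fin n) (L : List β)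
    (hL : L.Pairwise fun x y => g x ≤ g y) :
    (List.ofFn fun i => L.filter fun x => g x = i).flatten = L := by
  have := flatten_map_filter_range (fun x => (g x : ℕ)) L hL n
  simp only [Fin.is_lt, decide_true, List.filter_true] at this
  rw [← List.map_coe_finRange_eq_range, List.map_map] at this
  rw [List.ofFn_eq_map]
  simpa only [Function.comp_def, Fin.val_inj] using this

theorem flatten_ofFn_ite {β : Type*} {n : ℕ} (i : Fin n) (A : Fin n → List β) :
    (List.ofFn fun i' => if i' = i then A i' else []).flatten = A i := by
  induction n with
  | zero => exact i.elim0
  | succ n ih =>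
    rw [List.ofFn_succ, List.flatten_cons]
    cases i using Fin.cases with
    | zero =>
      simp [Fin.succ_ne_zero]
    | succ i =>
      simp only [Fin.succ_inj, (Fin.succ_ne_zero i).symm, if_false, List.nil_append]
      exact ih i fun i' => A i'.succ

variable {α : Type*} {n : ℕ}

/-- The letters of a word together with their labels. -/
def labelled (l : List α) (g : Fin l.length → Fin n) : List (α × Fin n) :=
  (List.finRange l.length).map fun x => (l.get x, g x)

/-- The subword of the letters labelled `i`. -/
def labelFiber (l : List α) (g : Fin l.length → Fin n) (i : Fin n) : List α :=
  ((List.finRange l.length).filter fun x => g x = i).map l.get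

theorem labelled_injective (l : List α) :
    Function.Injective (labelled l : (Fin l.length → Fin n) → _) := by
  intro g g' h
  funext x
  have := List.map_inj_left.1 h x (List.mem_finRange x)
  exact (Prod.ext_iff.1 this).2

theorem filter_labelled (l : List α) (g : Fin l.length → Fin n) (i : Fin n) :
    (labelled l g).filter (fun z => z.2 = i) = (labelFiber l g i).map fun a => (a, i) := by
  rw [labelled, labelFiber, List.filter_map, List.map_map]
  refine List.map_congr_left fun x hx => ?_
  simp only [List.mem_filter, Function.comp_def, decide_eq_true_eq] at hx
  simp [hx.2]

theorem labelled_pairwise (l : List α) {g : Fin l.length → Fin n} (hg : Monotone g) :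
    (labelled l g).Pairwise fun z z' => z.2 ≤ z'.2 := by
  rw [labelled, List.pairwise_map]
  exact (List.pairwise_lt_finRange _).imp fun h => hg h.le

theorem labelled_eq (l : List α) {g : Fin l.length → Fin n} (hg : Monotone g) :
    labelled l g = (List.ofFn fun i => (labelFiber l g i).map fun a => (a, i)).flatten := by
  simp only [← filter_labelled]
  exact (flatten_ofFn_filter _ _ (labelled_pairwise l hg)).symm

theorem flatten_labelFiber (l : List α) {g : Fin l.length → Fin n} (hg : Monotone g) :
    (List.ofFn fun i => labelFiber l g i).flatten = l := by
  have h := congrArg (List.map Prod.fst) (labelled_eq l hg)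
  rw [List.map_flatten, List.map_ofFn] at h
  simp only [Function.comp_def, List.map_map, List.map_id'] at h
  rw [← h, labelled, List.map_map]
  exact List.map_get_finRange l

/-- Equal letters cannot be told apart inside a word, so the letters are tagged by their labels: the
tagged word is the concatenation of the tagged fibres, and it determines the labelling. -/
theorem labelFiber_injective (l : List α) {g g' : Fin l.length → Fin n} (hg : Monotone g)
    (hg' : Monotone g') (h : ∀ i, labelFiber l g i = labelFiber l g' i) : g = g' := by
  apply labelled_injective l
  rw [labelled_eq l hg, labelled_eq l hg']
  simp only [h]

theorem exists_labelFiber_eq (l : List α) (v : Fin n → List α) (hv : (List.ofFn v).flatten = l) :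
    ∃ g : Fin l.length → Fin n, Monotone g ∧ ∀ i, labelFiber l g i = v i := by
  -- Each letter of the `i`-th factor is tagged with `i`; the sought labelling is the list of tags
  -- of the concatenation.
  set Z : List (α × Fin n) := (List.ofFn fun i => (v i).map fun a => (a, i)).flatten with hZ
  have hfst : Z.map Prod.fst = l := by
    rw [hZ, List.map_flatten, List.map_ofFn, ← hv]
    simp [Function.comp_def]
  have hsorted : Z.Pairwise fun z z' => z.2 ≤ z'.2 := by
    rw [hZ, List.pairwise_flatten]
    refine ⟨?_, ?_⟩
    · intro L hL
      obtain ⟨i, rfl⟩ := (List.mem_ofFn' _ _).1 hL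
      rw [List.pairwise_map]
      exact List.pairwise_of_forall fun _ _ => le_rfl
    · rw [List.pairwise_ofFn]
      intro i j hij z hz z' hz'
      simp only [List.mem_map] at hz hz'
      obtain ⟨_, _, rfl⟩ := hz
      obtain ⟨_, _, rfl⟩ := hz'
      exact hij.le
  have hlen : l.length = Z.length := by rw [← hfst, List.length_map]
  set g : Fin l.length → Fin n := fun x => (Z.get (x.cast hlen)).2 with hg
  have hlab : labelled l g = Z := by
    apply List.ext_getElem
    · simp [labelled, hlen]
    · intro i h1 h2
      simp only [labelled, List.getElem_map, List.getElem_finRange, hg, List.get_eq_getElem]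
      refine Prod.ext ?_ rfl
      simp only [Fin.val_cast]
      simp only [← hfst, List.getElem_map]
  refine ⟨g, ?_, fun i => ?_⟩
  · intro x y hxy
    rcases hxy.eq_or_lt with rfl | h
    · exact le_rfl
    · exact List.pairwise_iff_getElem.1 hsorted _ _ _ _ h
  · have h1 := filter_labelled l g i
    rw [hlab] at h1
    have h2 : Z.filter (fun z => z.2 = i) = (v i).map fun a => (a, i) := by
      rw [hZ, List.filter_flatten, List.map_ofFn]
      rw [← flatten_ofFn_ite i fun i' => (v i').map fun a => (a, i')]
      congr 2
      funext i'
      simp only [Function.comp_def, List.filter_map]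
      split_ifs with h
      · simp [h]
      · simp [h]
    have h3 := congrArg (List.map Prod.fst) (h1.symm.trans h2)
    simpa [List.map_map, Function.comp_def] using h3

end Labellings

/-! ### Order-preserving maps and factorisations -/

section Factorisations

/-- The fibres of a map, as finsets. -/
def fiber {P β : Type*} [Fintype P] [DecidableEq β] (f : P → β) (i : β) : Finset P :=
  Finset.univ.filter fun x => f x = i

theorem mem_fiber {P β : Type*} [Fintype P] [DecidableEq β] {f : P → β} {i : β} {x : P} :
    x ∈ fiber f i ↔ f x = i := by simp [fiber]

theorem subword_fiber {k n : ℕ} (τ : Fin k → Word d) (f : WordPoset τ → Fin n) (i : Fin n)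
    (j : Fin k) : subword τ (fiber f i) j = labelFiber (τ j) (fun x => f ⟨j, x⟩) i := by
  simp only [subword, labelFiber, mem_fiber]

theorem monotone_wordPoset_iff {k n : ℕ} {τ : Fin k → Word d} {f : WordPoset τ → Fin n} :
    Monotone f ↔ ∀ j, Monotone fun x => f ⟨j, x⟩ := by
  constructor
  · intro h j x y hxy
    exact h (Sigma.mk_le_mk_iff.2 hxy)
  · rintro h _ _ ⟨j, x, y, hxy⟩
    exact h j hxy

-- The chains are mutually incomparable, so an order-preserving map is an independent choice of a
-- monotone labelling of each word, that is, of a factorisation of each word. Labels outside the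
-- image give tuples of empty words.
open scoped Classical in
theorem sum_factorisations {k : ℕ} (n : ℕ) (τ : Fin k → Word d)
    (Φ : (Fin n → Fin k → Word d) → ℝ) :
    ∑ v ∈ factorisations n τ, Φ v =
      ∑ f : WordPoset τ → Fin n with Monotone f, Φ fun i => subword τ (fiber f i) := by
  symm
  refine Finset.sum_bij (fun f _ => fun i => subword τ (fiber f i)) ?_ ?_ ?_ ?_
  · intro f hf
    rw [Finset.mem_filter, monotone_wordPoset_iff] at hf
    rw [mem_factorisations]
    intro j
    simp only [subword_fiber]
    exact flatten_labelFiber _ (hf.2 j)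
  · intro f hf f' hf' h
    rw [Finset.mem_filter, monotone_wordPoset_iff] at hf hf'
    funext ⟨j, x⟩
    refine congrFun (labelFiber_injective (τ j) (hf.2 j) (hf'.2 j) fun i => ?_) x
    have := congrFun (congrFun h i) j
    rwa [subword_fiber, subword_fiber] at this
  · intro v hv
    rw [mem_factorisations] at hv
    choose g hg hg' using fun j => exists_labelFiber_eq (τ j) (fun i => v i j) (hv j)
    refine ⟨fun x => g x.1 x.2, ?_, ?_⟩
    · rw [Finset.mem_filter, monotone_wordPoset_iff]
      exact ⟨Finset.mem_univ _, hg⟩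
    · funext i j
      rw [subword_fiber]
      exact hg' j i
  · intro f _
    rfl

end Factorisations

/-! ### Grouping order-preserving maps by their kernels -/

section Kernels

variable {P : Type*} [Fintype P] [DecidableEq P]

/-- The blocks are the nonempty fibres of `f`; hence block counts, products over blocks and
uniqueness of the kernel can all be read off from `f`. -/
theorem IsKer.parts_eq {β : Type*} [DecidableEq β] {a : Finpartition (Finset.univ : Finset P)}
    {f : P → β} (h : IsKer a f) : a.parts = (Finset.univ.image f).image (fiber f) := by
  have key : ∀ b ∈ a.parts, ∀ x ∈ b, b = fiber f (f x) := by
    intro b hb x hx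
    ext y
    rw [mem_fiber]
    constructor
    · intro hy
      exact (h y x).2 ⟨b, hb, hy, hx⟩
    · intro hy
      obtain ⟨b', hb', hy', hx'⟩ := (h y x).1 hy
      rwa [a.eq_of_mem_parts hb hb' hx hx']
  ext b
  simp only [Finset.mem_image, Finset.mem_univ, true_and, exists_exists_eq_and]
  constructor
  · intro hb
    obtain ⟨x, hx⟩ := a.nonempty_of_mem_parts hb
    exact ⟨x, (key b hb x hx).symm⟩
  · rintro ⟨x, rfl⟩
    obtain ⟨b, hb, hx, -⟩ := (h x x).1 rfl
    rwa [← key b hb x hx]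

theorem fiber_injOn {Q β : Type*} [Fintype Q] [DecidableEq β] (f : Q → β) :
    Set.InjOn (fiber f) (Finset.univ.image f : Finset β) := by
  intro i hi i' _ h
  simp only [Finset.coe_image, Finset.coe_univ, Set.image_univ, Set.mem_range] at hi
  obtain ⟨x, rfl⟩ := hi
  have : x ∈ fiber f i' := h ▸ mem_fiber.2 rfl
  exact mem_fiber.1 this

theorem IsKer.numBlocks_eq {β : Type*} [DecidableEq β]
    {a : Finpartition (Finset.univ : Finset P)} {f : P → β} (h : IsKer a f) :
    numBlocks a = (Finset.univ.image f).card := by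
  rw [numBlocks, h.parts_eq, Finset.card_image_of_injOn (fiber_injOn f)]

theorem IsKer.numBlocks_eq_iff {n : ℕ} {a : Finpartition (Finset.univ : Finset P)}
    {f : P → Fin n} (h : IsKer a f) : numBlocks a = n ↔ Function.Surjective f := by
  rw [h.numBlocks_eq]
  constructor
  · intro hc i
    have := Finset.eq_univ_of_card _ (hc.trans (Fintype.card_fin n).symm)
    have hi : i ∈ Finset.univ.image f := by rw [this]; exact Finset.mem_univ i
    simpa using hi
  · intro hs
    rw [Finset.image_univ_of_surjective hs, Finset.card_univ, Fintype.card_fin]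

theorem IsKer.eq {β : Type*} {a a' : Finpartition (Finset.univ : Finset P)} {f : P → β}
    (h : IsKer a f) (h' : IsKer a' f) : a = a' := by
  classical
  exact Finpartition.ext (h.parts_eq.trans h'.parts_eq.symm)

theorem exists_isKer {β : Type*} (f : P → β) :
    ∃ a : Finpartition (Finset.univ : Finset P), IsKer a f := by
  classical
  refine ⟨Finpartition.ofSetoid (Setoid.ker f), fun x y => ?_⟩
  rw [← Setoid.ker_def, ← Finpartition.mem_part_ofSetoid_iff_rel]
  constructor
  · intro h
    exact ⟨_, Finpartition.part_mem _ |>.2 (Finset.mem_univ x),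
      Finpartition.mem_part _ (Finset.mem_univ x), h⟩
  · rintro ⟨b, hb, hx, hy⟩
    rwa [Finpartition.part_eq_of_mem _ hb hx]

theorem IsKer.prod_parts {n : ℕ} {a : Finpartition (Finset.univ : Finset P)} {f : P → Fin n}
    (h : IsKer a f) (hf : Function.Surjective f) (Ψ : Finset P → ℝ) :
    ∏ b ∈ a.parts, Ψ b = ∏ i, Ψ (fiber f i) := by
  rw [h.parts_eq, Finset.prod_image (fiber_injOn f), Finset.image_univ_of_surjective hf]

theorem numBlocks_le_card (a : Finpartition (Finset.univ : Finset P)) :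
    numBlocks a ≤ Fintype.card P := a.card_parts_le_card

variable [PartialOrder P]

-- An unused label contributes the factor `Ψ ∅ = 0`, so only surjections survive. A surjection onto
-- `Fin n` has a kernel with `n` blocks, its summand depends only on that kernel, and each kernel
-- occurs `factorial a` times.
open scoped Classical in
theorem sum_monotone_eq_sum_orp (n : ℕ) (Ψ : Finset P → ℝ) (h0 : Ψ ∅ = 0) :
    ∑ f : P → Fin n with Monotone f, ∏ i, Ψ (fiber f i) =
      ∑ a ∈ (Orp P).filter (fun a => numBlocks a = n),
        (factorial a : ℝ) * ∏ b ∈ a.parts, Ψ b := by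
  -- Each summand becomes a sum over partitions supported at most at the kernel of `f`, so that the
  -- two summations can be exchanged.
  have h1 : ∀ f ∈ (Finset.univ.filter fun f : P → Fin n => Monotone f),
      ∏ i, Ψ (fiber f i) = ∑ a ∈ (Orp P).filter (fun a => numBlocks a = n),
        if IsKer a f then ∏ b ∈ a.parts, Ψ b else 0 := by
    intro f hf
    rw [Finset.mem_filter] at hf
    obtain ⟨a, ha⟩ := exists_isKer f
    by_cases hs : Function.Surjective f
    · rw [Finset.sum_eq_single a, if_pos ha, ha.prod_parts hs]
      · intro a' _ hne
        exact if_neg fun h => hne (h.eq ha)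
      · intro hn
        refine absurd ?_ hn
        rw [Finset.mem_filter, Orp, Finset.mem_filter]
        refine ⟨⟨Finset.mem_univ _, ⟨fun x => (f x : ℕ), fun x y hxy => hf.2 hxy⟩, ?_⟩,
          ha.numBlocks_eq_iff.2 hs⟩
        intro x y
        rw [← ha x y]
        exact Fin.val_inj
    · rw [Finset.sum_eq_zero]
      · simp only [Function.Surjective, not_forall, not_exists] at hs
        obtain ⟨i, hi⟩ := hs
        refine Finset.prod_eq_zero (Finset.mem_univ i) ?_
        have : fiber f i = ∅ := by
          ext x; simp [mem_fiber, hi x]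
        rw [this, h0]
      · intro a' ha'
        rw [Finset.mem_filter] at ha'
        exact if_neg fun h => hs (h.numBlocks_eq_iff.1 ha'.2)
  rw [Finset.sum_congr rfl h1, Finset.sum_comm]
  refine Finset.sum_congr rfl fun a ha => ?_
  rw [Finset.mem_filter] at ha
  rw [← Finset.sum_filter, Finset.sum_const, nsmul_eq_mul, Finset.filter_filter]
  congr 2
  obtain ⟨-, rfl⟩ := ha
  rw [factorial, ← Fintype.card_subtype, ← Nat.card_eq_fintype_card]
  exact Nat.card_congr
    { toFun := fun f => ⟨⟨f.1, f.2.1⟩, f.2.2⟩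
      invFun := fun f => ⟨f.1, f.1.monotone, f.2⟩
      left_inv := fun _ => rfl
      right_inv := fun _ => rfl }

/-- An ordered partition of a chain is the kernel of exactly one order-preserving map onto
`{1, …, |a|}`. -/
theorem factorial_eq_one_of_total (hP : ∀ x y : P, x ≤ y ∨ y ≤ x)
    {a : Finpartition (Finset.univ : Finset P)} (ha : a ∈ Orp P) : factorial a = 1 := by
  classical
  rw [Orp, Finset.mem_filter] at ha
  obtain ⟨-, f₀, hf₀⟩ := ha
  rw [factorial, Nat.card_eq_one_iff_unique]
  refine ⟨⟨?_⟩, ?_⟩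
  · rintro ⟨f, hf⟩ ⟨g, hg⟩
    -- On a total order, `f x < f y` forces `x ≤ y`, and the common kernel makes the inequality for
    -- `g` strict.
    have hlt : ∀ x y, f x < f y → g x < g y := by
      intro x y h
      have hxy : x ≤ y := (hP x y).resolve_right fun h' => (f.monotone h').not_gt h
      refine lt_of_le_of_ne (g.monotone hxy) fun h' => h.ne ?_
      exact (hf x y).2 ((hg x y).1 h')
    -- With a section `s` of `f`, the map `g ∘ s` is a strictly monotone self-map of `Fin (numBlocks
    -- a)`, hence the identity.
    obtain ⟨s, hs⟩ := (hf.numBlocks_eq_iff.1 rfl).hasRightInverse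
    have hmono : StrictMono fun i => g (s i) := by
      intro i j hij
      apply hlt
      rwa [hs i, hs j]
    have hid : (fun i => g (s i)) = id := by
      refine (hmono.range_inj strictMono_id).1 ?_
      rw [(Finite.surjective_of_injective hmono.injective).range_eq, Set.range_id]
    rw [Subtype.mk.injEq]
    ext1
    funext x
    have h1 : f (s (f x)) = f x := hs (f x)
    have h2 : g (s (f x)) = g x := (hg _ _).2 ((hf _ _).1 h1)
    rw [← h2]
    exact (congrFun hid (f x)).symm
  · have hc : (Finset.univ.image f₀).card = numBlocks a := hf₀.numBlocks_eq.symm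
    -- Existence: each value of `f₀` is replaced by its rank in the image.
    let e := (Finset.univ.image f₀).orderIsoOfFin hc
    refine ⟨⟨fun x => e.symm ⟨f₀ x, Finset.mem_image_of_mem _ (Finset.mem_univ x)⟩, ?_⟩, ?_⟩
    · intro x y hxy
      exact e.symm.monotone (Subtype.mk_le_mk.2 (f₀.monotone hxy))
    · intro x y
      rw [← hf₀ x y]
      change e.symm ⟨f₀ x, _⟩ = e.symm ⟨f₀ y, _⟩ ↔ _
      rw [e.symm.injective.eq_iff, Subtype.mk.injEq]

end Kernels

theorem subword_empty {d k : ℕ} (τ : Fin k → Word d) : subword τ ∅ = fun _ => [] := by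
  funext j
  simp [subword]

theorem pairing_pow_eq_sum_orp {d k : ℕ} (n : ℕ) (τ : Fin k → Word d) (x : TensorSeries d)
    (hx : x [] = 0) :
    pairing (x ^ n) (shuffleWords τ) =
      ∑ a ∈ (Orp (WordPoset τ)).filter (fun a => numBlocks a = n),
        (factorial a : ℝ) * ∏ b ∈ a.parts, pairing x (shuffleWords (subword τ b)) := by
  classical
  rw [pairing_pow_shuffleWords, sum_factorisations]
  rw [sum_monotone_eq_sum_orp n (fun b => pairing x (shuffleWords (subword τ b)))]
  rw [subword_empty, pairing_shuffleWords]
  rw [multiShuffleSum_congr (G := fun w => 0 * coeff x w), multiShuffleSum_mul_left, zero_mul]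
  intro w hw
  have : w = [] := by simpa using hw
  rw [this, zero_mul, coeff_apply, hx]

/-! ### The logarithm and the exponential of a series -/

section ExpLog

open Polynomial

/-- The truncated exponential series. -/
noncomputable def expPoly (N : ℕ) : ℝ[X] :=
  ∑ n ∈ Finset.range (N + 1), C (1 / (n.factorial : ℝ)) * X ^ n

/-- The truncated series of `log (1 + X)`. -/
noncomputable def logPoly (N : ℕ) : ℝ[X] :=
  ∑ n ∈ Finset.Icc 1 N, C ((-1 : ℝ) ^ (n + 1) / (n : ℝ)) * X ^ n

theorem expPoly_succ (N : ℕ) :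
    expPoly (N + 1) = expPoly N + C (1 / ((N + 1).factorial : ℝ)) * X ^ (N + 1) := by
  rw [expPoly, Finset.sum_range_succ, ← expPoly]

theorem logPoly_succ (N : ℕ) :
    logPoly (N + 1) = logPoly N + C ((-1 : ℝ) ^ (N + 2) / ((N + 1 : ℕ) : ℝ)) * X ^ (N + 1) := by
  rw [logPoly, Finset.sum_Icc_succ_top (by omega), ← logPoly]

theorem derivative_expPoly (N : ℕ) :
    derivative (expPoly N) = expPoly N - C (1 / (N.factorial : ℝ)) * X ^ N := by
  induction N with
  | zero => simp [expPoly]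
  | succ N ih =>
    rw [expPoly_succ, derivative_add, ih, derivative_C_mul, derivative_X_pow, Nat.add_sub_cancel]
    have : (C (1 / ((N + 1).factorial : ℝ)) * (C ((N + 1 : ℕ) : ℝ) * X ^ N) : ℝ[X]) =
        C (1 / (N.factorial : ℝ)) * X ^ N := by
      rw [← mul_assoc, ← C_mul]
      congr 2
      rw [Nat.factorial_succ]
      have h1 : (N.factorial : ℝ) ≠ 0 := by positivity
      have h2 : ((N + 1 : ℕ) : ℝ) ≠ 0 := by positivity
      push_cast at *
      field_simp
    rw [this]
    ring

theorem one_add_X_mul_derivative_logPoly (N : ℕ) :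
    (1 + X) * derivative (logPoly N) = 1 - (-X) ^ N := by
  induction N with
  | zero => simp [logPoly]
  | succ N ih =>
    rw [logPoly_succ, derivative_add, derivative_C_mul, derivative_X_pow, Nat.add_sub_cancel]
    have : (C ((-1 : ℝ) ^ (N + 2) / ((N + 1 : ℕ) : ℝ)) * (C ((N + 1 : ℕ) : ℝ) * X ^ N) : ℝ[X]) =
        (-X) ^ N := by
      rw [← mul_assoc, ← C_mul]
      have h2 : ((N + 1 : ℕ) : ℝ) ≠ 0 := by positivity
      rw [div_mul_cancel₀ _ h2, neg_pow (X : ℝ[X]) N, pow_add]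
      simp
    rw [this, mul_add, ih]
    ring

theorem X_dvd_logPoly (N : ℕ) : X ∣ logPoly N := by
  refine Finset.dvd_sum fun n hn => ?_
  exact Dvd.dvd.mul_left (dvd_pow_self X (by have := Finset.mem_Icc.1 hn; omega)) _

/-- Since `1 + X` solves `(1 + X) y' = y`, and the truncated composite does so modulo `X ^ N`, so
does the difference `r`. Comparing coefficients gives `(n + 1) r_{n+1} = (1 - n) r_n` for `n < N`,
and `r_0 = 0`. -/
theorem X_pow_dvd_expPoly_comp_logPoly (N : ℕ) :
    X ^ (N + 1) ∣ (expPoly N).comp (logPoly N) - 1 - X := by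
  set r := (expPoly N).comp (logPoly N) - 1 - X with hr
  have hdvd : X ^ N ∣ (1 + X) * derivative r - r := by
    have h1 : (1 + X) * derivative r - r =
        (1 + X) * derivative ((expPoly N).comp (logPoly N)) - (expPoly N).comp (logPoly N) := by
      rw [hr]
      simp only [derivative_sub, derivative_one, derivative_X]
      ring
    rw [h1, derivative_comp, ← mul_assoc, one_add_X_mul_derivative_logPoly, derivative_expPoly]
    simp only [sub_comp, mul_comp, C_comp, X_pow_comp]
    have h2 : X ^ N ∣ logPoly N ^ N := pow_dvd_pow_of_dvd (X_dvd_logPoly N) N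
    obtain ⟨g, hg⟩ := h2
    rw [hg, neg_pow]
    exact ⟨- ((-1) ^ N * (expPoly N).comp (logPoly N)) - (1 - (-1) ^ N * X ^ N) *
      C (1 / (N.factorial : ℝ)) * g, by ring⟩
  rw [X_pow_dvd_iff] at hdvd ⊢
  intro n hn
  induction n with
  | zero =>
    have h0 : (logPoly N).coeff 0 = 0 := X_dvd_iff.1 (X_dvd_logPoly N)
    rw [coeff_zero_eq_eval_zero] at h0
    rw [coeff_zero_eq_eval_zero, hr]
    simp only [eval_sub, eval_comp, h0, eval_one, eval_X, sub_zero]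
    rw [expPoly, eval_finsetSum, Finset.sum_range_succ']
    simp
  | succ n ih =>
    have h := hdvd n (by omega)
    have ihn := ih (by omega)
    rw [coeff_sub, add_mul, one_mul, coeff_add, coeff_derivative] at h
    have hx : (X * derivative r).coeff n = n * r.coeff n := by
      cases n with
      | zero => simp
      | succ n => rw [coeff_X_mul, coeff_derivative]; push_cast; ring
    rw [hx, ihn, mul_zero, add_zero, sub_zero] at h
    exact (mul_eq_zero.1 h).resolve_right (by positivity)

end ExpLog

/-! ### Evaluating truncated series at a tensor series -/

namespace TensorSeries

instance : Module ℝ (TensorSeries d) where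
  smul c x := fun w => c * x w
  one_smul x := funext fun w => one_mul (x w)
  mul_smul a b x := funext fun w => mul_assoc a b (x w)
  smul_zero a := funext fun _ => mul_zero a
  smul_add a x y := funext fun w => mul_add a (x w) (y w)
  add_smul a b x := funext fun w => add_mul a b (x w)
  zero_smul x := funext fun w => zero_mul (x w)

theorem smul_apply (c : ℝ) (x : TensorSeries d) (w : Word d) : (c • x) w = c * x w := rfl

instance : Algebra ℝ (TensorSeries d) :=
  Algebra.ofModule
    (fun c x y => by
      funext w; simp only [mul_apply, smul_apply, Finset.mul_sum, mul_assoc])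
    (fun c x y => by
      funext w; simp only [mul_apply, smul_apply, Finset.mul_sum, mul_left_comm])

theorem sum_apply {ι : Type*} (s : Finset ι) (x : ι → TensorSeries d) (w : Word d) :
    (∑ i ∈ s, x i) w = ∑ i ∈ s, x i w := by
  classical
  induction s using Finset.induction_on with
  | empty => simp [zero_apply]
  | insert a s ha ih => rw [Finset.sum_insert ha, Finset.sum_insert ha, add_apply, ih]

/-- Two series agree up to level `N`. -/
def AgreeUpTo (N : ℕ) (x y : TensorSeries d) : Prop := ∀ w : Word d, w.length ≤ N → x w = y w

theorem AgreeUpTo.mul {N : ℕ} {x x' y y' : TensorSeries d} (hx : AgreeUpTo N x x')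
    (hy : AgreeUpTo N y y') : AgreeUpTo N (x * y) (x' * y') := by
  intro w hw
  rw [mul_apply, mul_apply]
  refine Finset.sum_congr rfl fun i _ => ?_
  rw [hx _ (by simp; omega), hy _ (by simp; omega)]

theorem AgreeUpTo.pow {N : ℕ} {x x' : TensorSeries d} (hx : AgreeUpTo N x x') (n : ℕ) :
    AgreeUpTo N (x ^ n) (x' ^ n) := by
  induction n with
  | zero => simp only [pow_zero]; exact fun _ _ => rfl
  | succ n ih => simp only [pow_succ]; exact ih.mul hx

/-- Raising the cut-off only adds vanishing terms; a cut-off independent of the word makes the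
logarithm a single polynomial in `x - 1` up to level `N`. -/
theorem log_apply_of_length_le (x : TensorSeries d) (hx : x [] = 1) {N : ℕ} {w : Word d}
    (hw : w.length ≤ N) :
    x.log w = ∑ n ∈ Finset.Icc 1 N, ((-1 : ℝ) ^ (n + 1) / (n : ℝ)) * ((x - 1) ^ n) w := by
  refine Finset.sum_subset (Finset.Icc_subset_Icc_right hw) fun n hn hn' => ?_
  rw [pow_apply_eq_zero, mul_zero]
  · rw [sub_apply, hx, one_apply]; simp
  · simp only [Finset.mem_Icc] at hn hn'; omega

theorem log_nil (x : TensorSeries d) : x.log [] = 0 := by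
  simp [log]

theorem log_agreeUpTo (x : TensorSeries d) (hx : x [] = 1) (N : ℕ) :
    AgreeUpTo N x.log (Polynomial.aeval (x - 1) (logPoly N)) := by
  intro w hw
  rw [log_apply_of_length_le x hx hw, logPoly, map_sum, sum_apply]
  refine Finset.sum_congr rfl fun n _ => ?_
  rw [Polynomial.C_mul', map_smul, map_pow, Polynomial.aeval_X, smul_apply]

/-- `exp (log x) = x`. -/
theorem apply_eq_sum_log_pow (x : TensorSeries d) (hx : x [] = 1) {N : ℕ} {w : Word d}
    (hw : w.length ≤ N) :
    x w = ∑ n ∈ Finset.range (N + 1), 1 / (n.factorial : ℝ) * (x.log ^ n) w := by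
  have h0 : (x - 1) [] = 0 := by rw [sub_apply, hx, one_apply]; simp
  obtain ⟨g, hg⟩ := X_pow_dvd_expPoly_comp_logPoly N
  have h := congrArg (Polynomial.aeval (x - 1)) hg
  rw [map_sub, map_sub, map_one, Polynomial.aeval_X, Polynomial.aeval_comp, map_mul, map_pow,
    Polynomial.aeval_X, sub_sub, add_sub_cancel] at h
  -- The error in the polynomial identity is a multiple of `(x - 1) ^ (N + 1)`, which lives above
  -- level `N`.
  have hz : ((x - 1) ^ (N + 1) * Polynomial.aeval (x - 1) g) w = 0 := by
    rw [mul_apply]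
    refine Finset.sum_eq_zero fun i _ => ?_
    rw [pow_apply_eq_zero _ h0 _ _ (by simp; omega), zero_mul]
  rw [← h, sub_apply, sub_eq_zero] at hz
  rw [← hz, expPoly, map_sum, sum_apply]
  refine Finset.sum_congr rfl fun n _ => ?_
  rw [Polynomial.C_mul', map_smul, map_pow, Polynomial.aeval_X, smul_apply,
    (log_agreeUpTo x hx N).pow n w hw]

end TensorSeries

/-! ### Cumulants of shuffles as sums over ordered partitions -/

theorem sum_map_length_ofFn {k : ℕ} (τ : Fin k → Word d) :
    ((List.ofFn τ).map List.length).sum = Fintype.card (WordPoset τ) := by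
  simp [List.map_ofFn, List.sum_ofFn]

theorem subword_ne_nil {k : ℕ} (τ : Fin k → Word d) {b : Finset (WordPoset τ)}
    (hb : b.Nonempty) : subword τ b ≠ fun _ => [] := by
  obtain ⟨⟨j, x⟩, hx⟩ := hb
  intro h
  have h' := congrFun h j
  simp only [subword, List.map_eq_nil_iff, List.filter_eq_nil_iff] at h'
  exact h' x (List.mem_finRange x) (by simpa using hx)

theorem pairing_sub (x y : TensorSeries d) (f : TensorPoly d) :
    pairing (x - y) f = pairing x f - pairing y f := by
  simp [pairing, TensorSeries.sub_apply, sub_mul, Finsupp.sum]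

theorem sum_orp_fiberwise {k : ℕ} (τ : Fin k → Word d)
    (G : Finpartition (Finset.univ : Finset (WordPoset τ)) → ℝ) {N : ℕ}
    (hN : Fintype.card (WordPoset τ) ≤ N) :
    ∑ a ∈ Orp (WordPoset τ), G a = ∑ n ∈ Finset.range (N + 1),
      ∑ a ∈ (Orp (WordPoset τ)).filter (fun a => numBlocks a = n), G a :=
  (Finset.sum_fiberwise_of_maps_to (fun a _ => Finset.mem_range.2
    (Nat.lt_succ_of_le ((numBlocks_le_card a).trans hN))) G).symm

/-- All words in the shuffle have the same length, so one truncation of the logarithm serves for all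
of them, and each power expands over ordered partitions. Blocks are nonempty, which allows `x - 1`
to be replaced by `x`. -/
theorem pairing_log_shuffleWords {k : ℕ} (τ : Fin k → Word d) (x : TensorSeries d)
    (hx : x [] = 1) :
    pairing x.log (shuffleWords τ) =
      ∑ a ∈ Orp (WordPoset τ), (-1 : ℝ) ^ (numBlocks a + 1) *
        ((factorial a : ℝ) / (numBlocks a : ℝ)) *
          ∏ b ∈ a.parts, pairing x (shuffleWords (subword τ b)) := by
  have h0 : (x - 1) [] = 0 := by
    rw [TensorSeries.sub_apply, hx, TensorSeries.one_apply]; simp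
  rw [pairing_shuffleWords]
  rw [multiShuffleSum_congr (G := fun w => ∑ n ∈ Finset.Icc 1 (Fintype.card (WordPoset τ)),
    ((-1 : ℝ) ^ (n + 1) / (n : ℝ)) * coeff ((x - 1) ^ n) w)]
  swap
  · intro w hw
    rw [sum_map_length_ofFn] at hw
    exact TensorSeries.log_apply_of_length_le x hx hw.le
  simp only [multiShuffleSum_sum, multiShuffleSum_mul_left]
  simp only [← pairing_shuffleWords, pairing_pow_eq_sum_orp _ _ _ h0]
  rw [sum_orp_fiberwise τ _ le_rfl]
  symm
  rw [← Finset.sum_subset (s₁ := Finset.Icc 1 (Fintype.card (WordPoset τ)))]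
  · refine Finset.sum_congr rfl fun n _ => ?_
    rw [Finset.mul_sum]
    refine Finset.sum_congr rfl fun a ha => ?_
    rw [Finset.mem_filter] at ha
    rw [ha.2]
    have : ∀ b ∈ a.parts, pairing x (shuffleWords (subword τ b)) =
        pairing (x - 1) (shuffleWords (subword τ b)) := by
      intro b hb
      rw [pairing_sub, pairing_one_shuffleWords,
        if_neg (subword_ne_nil τ (a.nonempty_of_mem_parts hb)), sub_zero]
    rw [Finset.prod_congr rfl this]
    ring
  · intro n hn
    simp only [Finset.mem_Icc, Finset.mem_range] at hn ⊢
    omega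
  · intro n hn hn'
    -- A partition with no blocks arises only when all words are empty; its coefficient is a
    -- division by zero, hence `0`, in agreement with the empty-tuple convention.
    have : n = 0 := by simp only [Finset.mem_Icc, Finset.mem_range] at hn hn'; omega
    refine Finset.sum_eq_zero fun a ha => ?_
    rw [Finset.mem_filter] at ha
    rw [ha.2, this]
    simp

theorem shuffleWords_one (τ : Fin 1 → Word d) (x : TensorSeries d) :
    pairing x (shuffleWords τ) = coeff x (τ 0) := by
  rw [pairing_shuffleWords, List.ofFn_succ, List.ofFn_zero, multiShuffleSum, multiShuffleSum,
    shuffleSum_nil_right]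

theorem apply_eq_sum_orp_log (τ : Word d) (x : TensorSeries d) (hx : x [] = 1) :
    x τ = ∑ a ∈ Orp (WordPoset fun _ : Fin 1 => τ), 1 / ((numBlocks a).factorial : ℝ) *
      ∏ b ∈ a.parts, coeff x.log (subword (fun _ : Fin 1 => τ) b 0) := by
  set T : Fin 1 → Word d := fun _ => τ
  have htot : ∀ y z : WordPoset T, y ≤ z ∨ z ≤ y := by
    rintro ⟨i, y⟩ ⟨j, z⟩
    obtain rfl : i = j := Subsingleton.elim _ _
    simpa only [Sigma.mk_le_mk_iff] using le_total y z
  have hcard : Fintype.card (WordPoset T) = τ.length := by simp [T]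
  rw [TensorSeries.apply_eq_sum_log_pow x hx le_rfl, sum_orp_fiberwise T _ hcard.le]
  refine Finset.sum_congr rfl fun n _ => ?_
  have h := pairing_pow_eq_sum_orp n T x.log (TensorSeries.log_nil x)
  rw [shuffleWords_one, coeff_apply] at h
  rw [h, Finset.mul_sum]
  refine Finset.sum_congr rfl fun a ha => ?_
  rw [Finset.mem_filter] at ha
  rw [factorial_eq_one_of_total htot ha.1, ha.2]
  simp only [shuffleWords_one, Nat.cast_one, one_mul]

/-! ### Vanishing of mixed cumulants -/

section Mixed

variable {I J : Set (Fin d)}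

theorem take_mem_wordsIn {u : Word d} (hu : u ∈ wordsIn I) (i : ℕ) : u.take i ∈ wordsIn I :=
  fun a ha => hu a (List.mem_of_mem_take ha)

theorem drop_mem_wordsIn {u : Word d} (hu : u ∈ wordsIn I) (i : ℕ) : u.drop i ∈ wordsIn I :=
  fun a ha => hu a (List.mem_of_mem_drop ha)

/-- The value of `(x ⊗ 1 + 1 ⊗ x)^n` at a pair of words. -/
def binomialSum (x : TensorSeries d) (n : ℕ) (u v : Word d) : ℝ :=
  ∑ p ∈ Finset.HasAntidiagonal.antidiagonal n, (n.choose p.1 : ℝ) * ((x ^ p.1) u * (x ^ p.2) v)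

theorem binomialSum_one (x : TensorSeries d) (u v : Word d) :
    binomialSum x 1 u v = x u * (1 : TensorSeries d) v + (1 : TensorSeries d) u * x v := by
  simp [binomialSum, Finset.Nat.antidiagonal_succ, add_comm]

/-- Pascal's rule for the commuting elements `x ⊗ 1` and `1 ⊗ x`, with the product of functions on
pairs of words written as a sum over cuts of both words. -/
theorem binomialSum_succ (x : TensorSeries d) (n : ℕ) (u v : Word d) :
    binomialSum x (n + 1) u v =
      ∑ i ∈ Finset.range (u.length + 1), ∑ j ∈ Finset.range (v.length + 1),
        binomialSum x 1 (u.take i) (v.take j) * binomialSum x n (u.drop i) (v.drop j) := by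
  have h1 : binomialSum x (n + 1) u v = ∑ p ∈ Finset.HasAntidiagonal.antidiagonal n, (n.choose p.1 : ℝ) *
      ((x * x ^ p.1) u * (1 * x ^ p.2) v + (1 * x ^ p.1) u * (x * x ^ p.2) v) := by
    rw [binomialSum,
      Finset.sum_antidiagonal_choose_succ_mul (fun i j => (x ^ i) u * (x ^ j) v) n,
      ← Finset.sum_add_distrib]
    refine Finset.sum_congr rfl fun p hp => ?_
    have : n.choose p.2 = n.choose p.1 := by
      rw [← Finset.HasAntidiagonal.mem_antidiagonal.1 hp]
      exact (Nat.choose_symm_add).symm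
    rw [this, pow_succ', pow_succ', one_mul, one_mul]
    ring
  rw [h1]
  simp only [binomialSum_one]
  simp only [binomialSum, Finset.mul_sum]
  rw [Finset.sum_congr rfl fun i _ => Finset.sum_comm, Finset.sum_comm]
  refine Finset.sum_congr rfl fun p _ => ?_
  simp only [TensorSeries.mul_apply, Finset.sum_mul_sum]
  rw [← Finset.sum_add_distrib, Finset.mul_sum]
  refine Finset.sum_congr rfl fun i _ => ?_
  rw [← Finset.sum_add_distrib, Finset.mul_sum]
  refine Finset.sum_congr rfl fun j _ => ?_
  ring

/-- The shuffle of any two non-empty words in `I` and `J` with total length less than `N` is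
annihilated by `x`. -/
def MixedVanishing (x : TensorSeries d) (I J : Set (Fin d)) (N : ℕ) : Prop :=
  ∀ u ∈ wordsIn I, ∀ v ∈ wordsIn J, u ≠ [] → v ≠ [] → u.length + v.length < N →
    shuffleSum u v (coeff x) = 0

/-- Primitivity below level `N`: the coproduct of `x` agrees with `x ⊗ 1 + 1 ⊗ x` on such pairs,
those with an empty word included. -/
theorem MixedVanishing.shuffleSum_eq {x : TensorSeries d} (hx : x [] = 0) {N : ℕ}
    (h : MixedVanishing x I J N) {u v : Word d} (hu : u ∈ wordsIn I) (hv : v ∈ wordsIn J)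
    (hN : u.length + v.length < N) : shuffleSum u v (coeff x) = binomialSum x 1 u v := by
  rw [binomialSum_one]
  by_cases hu0 : u = []
  · subst hu0
    simp [hx, TensorSeries.one_apply, coeff_apply]
  by_cases hv0 : v = []
  · subst hv0
    simp [hx, TensorSeries.one_apply, coeff_apply]
  rw [h u hu v hv hu0 hv0 hN]
  simp [TensorSeries.one_apply, hu0, hv0]

/-- The zeroth power does not depend on the series, so `0` serves as a placeholder in `binomialSum`.
-/
theorem shuffleSum_one (u v : Word d) :
    shuffleSum u v (coeff (1 : TensorSeries d)) = binomialSum 0 0 u v := by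
  have := pairing_one_shuffleWords (d := d) ![u, v]
  rw [pairing_shuffleWords] at this
  simp only [List.ofFn_succ, List.ofFn_zero, multiShuffleSum, shuffleSum_nil_right] at this
  simp only [Matrix.cons_val_zero, Matrix.cons_val_succ] at this
  rw [this]
  simp only [binomialSum, Finset.HasAntidiagonal.antidiagonal_zero, Finset.sum_singleton, pow_zero,
    TensorSeries.one_apply]
  by_cases hu : u = [] <;> by_cases hv : v = [] <;> simp [hu, hv, funext_iff, Fin.forall_fin_two]

theorem MixedVanishing.shuffleSum_pow {x : TensorSeries d} (hx : x [] = 0) {N : ℕ}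
    (h : MixedVanishing x I J N) (n : ℕ) {u v : Word d} (hu : u ∈ wordsIn I) (hv : v ∈ wordsIn J)
    (hN : u.length + v.length < N) : shuffleSum u v (coeff (x ^ n)) = binomialSum x n u v := by
  induction n generalizing u v with
  | zero => rw [pow_zero, shuffleSum_one]; simp [binomialSum]
  | succ n ih =>
    rw [pow_succ', shuffleSum_mul, binomialSum_succ]
    refine Finset.sum_congr rfl fun i _ => Finset.sum_congr rfl fun j _ => ?_
    rw [h.shuffleSum_eq hx (take_mem_wordsIn hu i) (take_mem_wordsIn hv j) (by simp; omega),
      ih (drop_mem_wordsIn hu i) (drop_mem_wordsIn hv j) (by simp; omega)]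

/-- Powers of order at least two gain one level. The full pair, where primitivity is unknown, is
multiplied by a positive power of `x` at empty words, which is `0`; every other cut involves shorter
pairs or a first factor at empty words, also `0`. -/
theorem MixedVanishing.shuffleSum_pow_of_le {x : TensorSeries d} (hx : x [] = 0) {N : ℕ}
    (h : MixedVanishing x I J N) (n : ℕ) {u v : Word d} (hu : u ∈ wordsIn I) (hv : v ∈ wordsIn J)
    (hN : u.length + v.length ≤ N) :
    shuffleSum u v (coeff (x ^ (n + 2))) = binomialSum x (n + 2) u v := by
  rw [pow_succ', shuffleSum_mul, binomialSum_succ]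
  refine Finset.sum_congr rfl fun i hi => Finset.sum_congr rfl fun j hj => ?_
  rw [Finset.mem_range] at hi hj
  by_cases h0 : i = 0 ∧ j = 0
  · obtain ⟨rfl, rfl⟩ := h0
    simp [coeff_apply, hx, binomialSum_one]
  have h1 := h.shuffleSum_pow hx (n + 1) (drop_mem_wordsIn hu i) (drop_mem_wordsIn hv j)
    (by simp; omega)
  by_cases h2 : i = u.length ∧ j = v.length
  · obtain ⟨rfl, rfl⟩ := h2
    rw [← h1]
    simp [coeff_apply, TensorSeries.pow_apply_eq_zero x hx (n + 1) [] (by simp)]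
  rw [h1, h.shuffleSum_eq hx (take_mem_wordsIn hu i) (take_mem_wordsIn hv j) (by simp; omega)]

/-- This is `exp (A + B) = exp A * exp B` for `A = x ⊗ 1` and `B = 1 ⊗ x`. The ranges match because
`x ^ i` vanishes on words shorter than `i`. -/
theorem sum_binomialSum {x : TensorSeries d} (hx : x [] = 0) (u v : Word d) :
    ∑ n ∈ Finset.range (u.length + v.length + 1), 1 / (n.factorial : ℝ) * binomialSum x n u v =
      (∑ i ∈ Finset.range (u.length + 1), 1 / (i.factorial : ℝ) * (x ^ i) u) *
        ∑ j ∈ Finset.range (v.length + 1), 1 / (j.factorial : ℝ) * (x ^ j) v := by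
  rw [Finset.sum_mul_sum, ← Finset.sum_product',
    ← Finset.sum_fiberwise_of_maps_to (g := fun p : ℕ × ℕ => p.1 + p.2)
      (t := Finset.range (u.length + v.length + 1))]
  swap
  · intro p hp
    simp only [Finset.mem_product, Finset.mem_range] at hp ⊢
    omega
  refine Finset.sum_congr rfl fun n _ => ?_
  rw [binomialSum, Finset.mul_sum]
  symm
  refine (Finset.sum_subset ?_ ?_).trans (Finset.sum_congr rfl ?_)
  · intro p hp
    rw [Finset.mem_filter] at hp
    exact Finset.HasAntidiagonal.mem_antidiagonal.2 hp.2
  · intro p hp hp'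
    rw [Finset.HasAntidiagonal.mem_antidiagonal] at hp
    simp only [Finset.mem_filter, Finset.mem_product, Finset.mem_range, not_and_or, hp] at hp'
    rcases hp' with (h | h) | h
    · rw [TensorSeries.pow_apply_eq_zero x hx p.1 u (by omega)]; simp
    · rw [TensorSeries.pow_apply_eq_zero x hx p.2 v (by omega)]; simp
    · exact absurd trivial h
  · intro p hp
    rw [Finset.HasAntidiagonal.mem_antidiagonal] at hp
    have h1 : ((p.1 + p.2).choose p.1 : ℝ) * p.1.factorial * p.2.factorial =
        (p.1 + p.2).factorial := by
      rw [Nat.choose_symm_add]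
      exact_mod_cast Nat.add_choose_mul_factorial_mul_factorial p.1 p.2
    have h2 : (p.1.factorial : ℝ) ≠ 0 := by positivity
    have h3 : (p.2.factorial : ℝ) ≠ 0 := by positivity
    have h4 : ((p.1 + p.2).factorial : ℝ) ≠ 0 := by positivity
    generalize (x ^ p.1) u = a, (x ^ p.2) v = b
    rw [← hp]
    field_simp
    linear_combination (-(a * b)) * h1

/-- The lowest order mixed cumulant is the failure of the moments to factorise. -/
theorem shuffleSum_eq_mul_add {x : TensorSeries d} (hx : x [] = 1) {u v : Word d}
    (hu : u ∈ wordsIn I) (hv : v ∈ wordsIn J) (hu0 : u ≠ []) (hv0 : v ≠ [])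
    (h : MixedVanishing x.log I J (u.length + v.length)) :
    shuffleSum u v (coeff x) = x u * x v + shuffleSum u v (coeff x.log) := by
  have hl := TensorSeries.log_nil x
  have hup := List.length_pos_of_ne_nil hu0
  rw [shuffleSum_congr (G := fun w => ∑ n ∈ Finset.range (u.length + v.length + 1),
    1 / (n.factorial : ℝ) * coeff (x.log ^ n) w)]
  swap
  · intro w hw
    exact TensorSeries.apply_eq_sum_log_pow x hx hw.le
  rw [TensorSeries.apply_eq_sum_log_pow x hx (le_refl u.length),
    TensorSeries.apply_eq_sum_log_pow x hx (le_refl v.length), ← sum_binomialSum hl]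
  simp only [shuffleSum_sum, shuffleSum_mul_left]
  obtain ⟨m, hm⟩ : ∃ m, u.length + v.length = m + 1 :=
    ⟨u.length + v.length - 1, by omega⟩
  -- The terms of order `0` and at least `2` agree on both sides. At order `1` the shuffle side has
  -- the mixed cumulant, while the binomial side is `0` because both words are nonempty.
  rw [hm, Finset.sum_range_succ', Finset.sum_range_succ', Finset.sum_range_succ' _ (m + 1),
    Finset.sum_range_succ' _ m]
  have h1 : binomialSum x.log (0 + 1) u v = 0 := by
    rw [zero_add, binomialSum_one]; simp [TensorSeries.one_apply, hu0, hv0]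
  have h0 : shuffleSum u v (coeff (x.log ^ 0)) = binomialSum x.log 0 u v := by
    rw [pow_zero, shuffleSum_one]; simp [binomialSum]
  rw [h0, h1, Finset.sum_congr rfl fun n _ => by
    rw [h.shuffleSum_pow_of_le hl n hu hv le_rfl]]
  simp
  ring

/-- The mixed cumulants vanish if and only if the mixed moments factorise. -/
theorem mixed_log_eq_zero_iff {x : TensorSeries d} (hx : x [] = 1) :
    (∀ u ∈ wordsIn I, ∀ v ∈ wordsIn J, u ≠ [] → v ≠ [] → shuffleSum u v (coeff x.log) = 0) ↔
      ∀ u ∈ wordsIn I, ∀ v ∈ wordsIn J, shuffleSum u v (coeff x) = x u * x v := by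
  constructor
  · intro h u hu v hv
    by_cases hu0 : u = []
    · subst hu0; simp [hx, coeff_apply]
    by_cases hv0 : v = []
    · subst hv0; simp [hx, coeff_apply]
    rw [shuffleSum_eq_mul_add hx hu hv hu0 hv0 fun u' hu' v' hv' h1 h2 _ => h u' hu' v' hv' h1 h2,
      h u hu v hv hu0 hv0, add_zero]
  · intro h
    -- Induction on total length: once all shorter mixed cumulants vanish, the next one equals the
    -- difference between mixed moment and product, which is `0` by `h`.
    have key : ∀ N, MixedVanishing x.log I J N := by
      intro N
      induction N with
      | zero => intro u _ v _ _ _ hlt; omega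
      | succ N ih =>
        intro u hu v hv hu0 hv0 hlt
        have := shuffleSum_eq_mul_add hx hu hv hu0 hv0
          fun u' hu' v' hv' h1 h2 h3 => ih u' hu' v' hv' h1 h2 (by omega)
        rw [h u hu v hv] at this
        linarith
    intro u hu v hv hu0 hv0
    exact key _ u hu v hv hu0 hv0 (Nat.lt_succ_self _)

end Mixed

/-! ### Measurability of the coordinates of the signature -/

variable {p : ℝ}

theorem TensorSeries.abs_apply_le_levelNorm (x : TensorSeries d) (w : Word d) :
    |x w| ≤ levelNorm w.length x := by
  have := Finset.single_le_sum (f := fun i : Fin w.length → Fin d => |x (List.ofFn i)|)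
    (fun _ _ => abs_nonneg _) (Finset.mem_univ w.get)
  rwa [List.ofFn_get] at this

theorem TensorSeries.continuous_coeff (w : Word d) :
    Continuous fun x : TensorSeries d => coeff x w := by
  rw [continuous_def]
  intro U hU x hx
  obtain ⟨ε, hε, hball⟩ := Metric.isOpen_iff.1 hU _ hx
  -- The weight `c = 1` suffices, since that single norm dominates the absolute value of every
  -- coordinate.
  refine ⟨1, one_pos, ENNReal.ofReal ε, ENNReal.ofReal_pos.2 hε, fun y hy => hball ?_⟩
  have h1 := (ENNReal.le_tsum (f := fun n => ENNReal.ofReal (levelNorm n (y - x) * 1 ^ n))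
    w.length).trans_lt hy
  rw [ENNReal.ofReal_lt_ofReal_iff hε, one_pow, mul_one] at h1
  exact (abs_apply_le_levelNorm (y - x) w).trans_lt h1

namespace UnparamRoughPath

theorem measurable_signature (w : Word d) :
    Measurable fun x : UnparamRoughPath d p => x.signature w := by
  have h : Continuous fun x : UnparamRoughPath d p => x.signature w :=
    (TensorSeries.continuous_coeff w).comp continuous_induced_dom
  exact h.measurable

theorem measurable_restrict (I : Set (Fin d)) :
    Measurable (restrict I : UnparamRoughPath d p → wordsIn I → ℝ) :=
  measurable_pi_lambda _ fun τ => measurable_signature τ.1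

/-! ### The shuffle identity -/

theorem signature_nil (x : UnparamRoughPath d p) : x.signature [] = 1 := by
  induction x using Quot.ind with
  | mk x => exact x.unit 0 x.T le_rfl x.T_pos.le le_rfl

theorem pairing_signature_shuffle (x : UnparamRoughPath d p) (f g : TensorPoly d) :
    pairing x.signature (shuffle f g) = pairing x.signature f * pairing x.signature g := by
  induction x using Quot.ind with
  | mk x => exact x.shuffle_mul 0 x.T le_rfl x.T_pos.le le_rfl f g

theorem pairing_signature_shuffleWords (x : UnparamRoughPath d p) {k : ℕ} (τ : Fin k → Word d) :
    pairing x.signature (shuffleWords τ) = ∏ j, x.signature (τ j) := by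
  rw [← List.prod_ofFn, shuffleWords]
  induction k with
  | zero => simp [coeff_apply, signature_nil]
  | succ k ih =>
    rw [List.ofFn_succ, List.foldr_cons, pairing_signature_shuffle, ih, pairing_basisElem,
      List.ofFn_succ, List.prod_cons]
    rfl

end UnparamRoughPath

/-! ### Signature moments -/

section Moments

variable {Ω : Type*} [MeasurableSpace Ω] {μ : Measure Ω} {X : Ω → UnparamRoughPath d p}

theorem integrable_signature
    (hint : ∀ f : TensorPoly d, Integrable (fun ω => pairing (X ω).signature f) μ) (w : Word d) :
    Integrable (fun ω => (X ω).signature w) μ := by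
  have h := hint (basisElem w)
  simp only [pairing_basisElem] at h
  exact h

theorem pairing_sigMoment
    (hint : ∀ f : TensorPoly d, Integrable (fun ω => pairing (X ω).signature f) μ)
    (f : TensorPoly d) :
    pairing (sigMoment μ X) f = ∫ ω, pairing (X ω).signature f ∂μ := by
  unfold pairing Finsupp.sum
  rw [integral_finsetSum _ fun w _ => (integrable_signature hint w).mul_const _]
  refine Finset.sum_congr rfl fun w _ => ?_
  rw [integral_mul_const]
  rfl

theorem sigMoment_nil [IsProbabilityMeasure μ] : sigMoment μ X [] = 1 := by
  simp [sigMoment, UnparamRoughPath.signature_nil]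

/-- A product of signature coordinates is the signature paired with the shuffle, hence linear in the
signature, so the expectation passes inside. Empty subwords only contribute factors `1`. -/
theorem genMoment_eq
    (hint : ∀ f : TensorPoly d, Integrable (fun ω => pairing (X ω).signature f) μ)
    {k : ℕ} (τ : Fin k → Word d) (a : Finpartition (Finset.univ : Finset (WordPoset τ))) :
    genMoment μ X τ a = ∏ b ∈ a.parts, pairing (sigMoment μ X) (shuffleWords (subword τ b)) := by
  refine Finset.prod_congr rfl fun b _ => ?_
  rw [pairing_sigMoment hint]
  refine integral_congr_ae (Filter.Eventually.of_forall fun ω => ?_)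
  simp only [UnparamRoughPath.pairing_signature_shuffleWords]
  refine Finset.prod_filter_of_ne fun j _ hj h => hj ?_
  rw [h, UnparamRoughPath.signature_nil]

theorem integral_signature_mul_signature
    (hint : ∀ f : TensorPoly d, Integrable (fun ω => pairing (X ω).signature f) μ)
    (u v : Word d) :
    ∫ ω, (X ω).signature u * (X ω).signature v ∂μ = shuffleSum u v (coeff (sigMoment μ X)) := by
  rw [← pairing_shuffle_basisElem_basisElem, pairing_sigMoment hint]
  simp only [UnparamRoughPath.pairing_signature_shuffle, pairing_basisElem]
  rfl

theorem mixed_moments_of_indepFun {I J : Set (Fin d)} (hX : Measurable X)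
    (h : IndepFun (fun ω => restrict I (X ω)) (fun ω => restrict J (X ω)) μ)
    {u v : Word d} (hu : u ∈ wordsIn I) (hv : v ∈ wordsIn J) :
    ∫ ω, (X ω).signature u * (X ω).signature v ∂μ = sigMoment μ X u * sigMoment μ X v := by
  have h' := h.comp (measurable_pi_apply (⟨u, hu⟩ : wordsIn I))
    (measurable_pi_apply (⟨v, hv⟩ : wordsIn J))
  exact h'.integral_fun_mul_eq_mul_integral
    ((UnparamRoughPath.measurable_signature u).comp hX).aestronglyMeasurable
    ((UnparamRoughPath.measurable_signature v).comp hX).aestronglyMeasurable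

/-- Two independent copies of `X` have the factorised mixed moments, so the characterisation
identifies the joint law of the restrictions with a product law. -/
theorem indepFun_of_mixed_moments [IsProbabilityMeasure μ] {I J : Set (Fin d)} (hX : Measurable X)
    (hint : ∀ w : Word d, Integrable (fun ω => (X ω).signature w) μ)
    (hchar : CharacterisedByMixedMoments μ X I J)
    (h : ∀ u ∈ wordsIn I, ∀ v ∈ wordsIn J,
      ∫ ω, (X ω).signature u * (X ω).signature v ∂μ = sigMoment μ X u * sigMoment μ X v) :
    IndepFun (fun ω => restrict I (X ω)) (fun ω => restrict J (X ω)) μ := by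
  have hI := UnparamRoughPath.measurable_restrict (p := p) I
  have hJ := UnparamRoughPath.measurable_restrict (p := p) J
  have : IsProbabilityMeasure (μ.map X) := Measure.isProbabilityMeasure_map hX.aemeasurable
  have hint' : ∀ w : Word d,
      Integrable (fun x : UnparamRoughPath d p => x.signature w) (μ.map X) := fun w =>
    (integrable_map_measure (UnparamRoughPath.measurable_signature w).aestronglyMeasurable
      hX.aemeasurable).2 (hint w)
  have hmom : ∀ w : Word d,
      ∫ x : UnparamRoughPath d p, x.signature w ∂(μ.map X) = sigMoment μ X w := fun w =>
    integral_map hX.aemeasurable (UnparamRoughPath.measurable_signature w).aestronglyMeasurable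
  have key := hchar ((μ.map X).prod (μ.map X)) inferInstance fun u hu v hv =>
    ⟨(hint' u).mul_prod (hint' v), by
      rw [h u hu v hv, ← hmom u, ← hmom v]
      exact integral_prod_mul (fun x : UnparamRoughPath d p => x.signature u)
        (fun x : UnparamRoughPath d p => x.signature v)⟩
  refine (indepFun_iff_map_prod_eq_prod_map_map (hI.comp hX).aemeasurable
    (hJ.comp hX).aemeasurable).2 ?_
  refine key.symm.trans ?_
  have h1 : μ.map (fun ω => restrict I (X ω)) = (μ.map X).map (restrict I) :=
    (Measure.map_map hI hX).symm
  have h2 : μ.map (fun ω => restrict J (X ω)) = (μ.map X).map (restrict J) :=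
    (Measure.map_map hJ hX).symm
  change _ = (μ.map fun ω => restrict I (X ω)).prod (μ.map fun ω => restrict J (X ω))
  -- Restricting each copy separately pushes the product of the laws to the product of the
  -- restricted laws.
  rw [h1, h2, Measure.map_prod_map _ _ hI hJ]
  rfl

end Moments

end SigCumulant

theorem theorem3p6 {Ω : Type*} [MeasurableSpace Ω] (μ : Measure Ω) [IsProbabilityMeasure μ]
    (d : ℕ) (p : ℝ) (hp : 1 ≤ p) (X : Ω → UnparamRoughPath d p) (hX : Measurable X)
    (hint : ∀ f : TensorPoly d, Integrable (fun ω => pairing (X ω).signature f) μ) :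
    (∀ (k : ℕ) (τ : Fin k → Word d),
      pairing (sigCumulant μ X) (shuffleWords τ) =
        ∑ a ∈ Orp (WordPoset τ),
          (-1 : ℝ) ^ (numBlocks a + 1) * ((factorial a : ℝ) / (numBlocks a : ℝ)) *
            genMoment μ X τ a) ∧
    (∀ τ : Word d,
      pairing (sigMoment μ X) (basisElem τ) =
        ∑ a ∈ Orp (WordPoset fun _ : Fin 1 => τ),
          1 / ((numBlocks a).factorial : ℝ) * genCumulant μ X τ a) ∧
    (∀ I J : Set (Fin d), CharacterisedByMixedMoments μ X I J →
      (IndepFun (fun ω => restrict I (X ω)) (fun ω => restrict J (X ω)) μ ↔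
        ∀ τ₁ ∈ wordsIn I, ∀ τ₂ ∈ wordsIn J, τ₁ ≠ [] → τ₂ ≠ [] →
          pairing (sigCumulant μ X) (shuffle (basisElem τ₁) (basisElem τ₂)) = 0)) := by
  have h1 : sigMoment μ X [] = 1 := sigMoment_nil
  refine ⟨fun k τ => ?_, fun τ => ?_, fun I J hchar => ?_⟩
  · simp only [genMoment_eq hint]
    exact pairing_log_shuffleWords τ _ h1
  · simp only [genCumulant, pairing_basisElem]
    exact apply_eq_sum_orp_log τ _ h1
  · simp only [pairing_shuffle_basisElem_basisElem, sigCumulant]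
    rw [mixed_log_eq_zero_iff h1]
    simp only [← integral_signature_mul_signature hint]
    exact ⟨fun h u hu v hv => mixed_moments_of_indepFun hX h hu hv,
      indepFun_of_mixed_moments hX (integrable_signature hint) hchar⟩
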